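/- **Setting.** Let $\mathcal G$ be the class of functions $G:[0,\infty)\to[0,\infty)$ of the form $$G(z)=c\,\mathbf 1_{\{z>0\}}+\gamma_0 z+\int_{(0,\infty)}(1-e^{-rz})\,\nu(dr),\qquad c,\gamma_0\ge 0,\quad \int_{(0,\infty)}\min(r,1)\,\nu(dr)<\infty,$$ with $\nu$ a non-negative measure. For $G\in\mathcal G$ let $(X_t)_{t\ge0}$ be the corresponding Lévy process with values in $[0,\infty]$, i.e. $\mathbb E e^{-zX_t}=e^{-tG(z)}$ for all $t,z\ge 0$, and let $\ell_G(a,b)=\inf\{t\ge 0:\mathbb P(X_t\ge a)\ge b\}$ be its level function. A vector $\mathbf x\in\mathbb R_+^n$, initially $0$, undergoes a fixed stream of updates $(v,\Delta)$, $v\in[n]$, $\Delta>0$, each setting $\mathbf x(v)\leftarrow\mathbf x(v)+\Delta$. Let $H(v)$, $v\in[n]$, be uniform on $[0,1]$, and let each update generate a fresh $Y\sim\mathrm{Exp}(1)$, all these variables being independent. Access to $H$ (a random oracle) is free; a word stores an index or a real number. Write $G(\mathbf x)=\sum_{v\in[n]}G(\mathbf x(v))$. *$(G,k)$-Sampler-WOR.*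 The state is a set $S$ of pairs $(v,h)$, initially empty. The update $(v,\Delta)$ adds $(v,\ell_G(Y/\Delta,H(v)))$ to $S$ and then applies $k$-Min: discard every pair $(v,h)$ for which some $(v,h')$ with $h'<h$ is present, then keep the $k$ pairs with smallest second coordinate (all of them if there are fewer than $k$; ties are broken by the index). It reports the stored indices in increasing order of $h$. A pair takes 2 words. *$k$-ParetoSampler-WOR.* The state is a set $S$ of triples $(a,b,v)$, initially empty. The update $(v,\Delta)$ adds $(Y/\Delta,H(v),v)$ to $S$, then discards every triple $(a,b,v)$ for which some $(a',b,v)$ with $a'<a$ is present, then keeps only the triples that are dominated by fewer than $k$ other triples, where $(a',b',v')$ dominates $(a,b,v)$ if $a'\le a$ and $b'\le b$. A query with $G\in\mathcal G$ applies $k$-Min to the pairs $(v,\ell_G(a,b))$, $(a,b,v)\in S$, and reports the resulting indices in increasing order of $\ell_G(a,b)$. A triple takes 3 words. **Theorem.** Let $n,k$ be non-negative integers. 1. Let $G\in\mathcal G$. At all times the state of the $(G,k)$-Sampler-WOR occupies at most $2k$ words. At every time at which at least $k$ indices $v$ satisfy $G(\mathbf x(v))>0$, it reports an ordered $k$-tuple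 $(v_*^1,\dots,v_*^k)$ of distinct indices, and for all distinct $v^1,\dots,v^k\in[n]$ $$\mathbb P\big((v_*^1,\dots,v_*^k)=(v^1,\dots,v^k)\big)=\prod_{i=1}^k\frac{G(\mathbf x(v^i))}{G(\mathbf x)-\sum_{j=1}^{i-1}G(\mathbf x(v^j))}.\qquad(*)$$ 2. For all non-negative integers $C,D$ there is a constant $K>0$, depending only on $C,D$, such that for all $n\ge 2$, all $k$ and every stream of at most $n^C$ updates, with probability at least $1-n^{-D}$ the $k$-ParetoSampler-WOR occupies at most $K\,k\log n$ words at all times during the stream. 3. At every time, for every $G\in\mathcal G$ given at query time (not depending on the random variables) such that at least $k$ indices $v$ satisfy $G(\mathbf x(v))>0$, the $k$-ParetoSampler-WOR almost surely reports an ordered $k$-tuple of distinct indices, and its distribution is given by $(*)$ for all distinct $v^1,\dots,v^k\in[n]$. -/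

import Mathlib

open MeasureTheory ProbabilityTheory Set Filter Topology
open scoped NNReal ENNReal

noncomputable section

namespace GSampling

/-! ### The class of weight functions and its Lévy-induced level functions -/

/-- The class `𝒢` of functions
`G z = c * 1_{z > 0} + γ₀ * z + ∫_{(0, ∞)} (1 - exp (-r z)) ν(dr)` on `[0, ∞)`, where `c, γ₀ ≥ 0` and
`ν` is a (non-negative) measure on `(0, ∞)` with `∫ min(r, 1) ν(dr) < ∞`.  (Only the restriction of
`ν` to `(0, ∞)` enters; the integrand is integrable under this condition.) -/
def classG : Set (ℝ≥0 → ℝ) :=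
  {G | ∃ (c γ₀ : ℝ≥0) (ν : Measure ℝ),
    (∫⁻ r in Ioi (0 : ℝ), ENNReal.ofReal (min r 1) ∂ν) < ∞ ∧
    ∀ z : ℝ≥0, G z = (if 0 < z then (c : ℝ) else 0) + (γ₀ : ℝ) * (z : ℝ)
      + ∫ r in Ioi (0 : ℝ), (1 - Real.exp (-(r * (z : ℝ)))) ∂ν}

/-- `μ t` is the law of `X t`, for a non-negative Lévy process `X` with values in `[0, ∞]`
(the value `∞` is the killed state).  Stationary and independent increments say that `X (s + t)` is
the sum of `X s` and of an independent variable distributed as `X t`, that is, that the laws form a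
convolution semigroup on `[0, ∞]`; the other two fields are `X 0 = 0` and stochastic continuity. -/
structure IsNonnegLevyLaw (μ : ℝ≥0 → Measure ℝ≥0∞) : Prop where
  isProbabilityMeasure : ∀ t, IsProbabilityMeasure (μ t)
  zero : μ 0 = Measure.dirac 0
  add : ∀ s t, μ (s + t) = Measure.conv (μ s) (μ t)
  stochasticContinuity : ∀ ε : ℝ≥0∞, 0 < ε →
    Tendsto (fun t : ℝ≥0 => μ t (Ioi ε)) (𝓝[>] 0) (𝓝 0)

/-- `𝔼 exp (-z X_t) = exp (-t G(z))` for all `t, z ≥ 0`, where `X_t` has law `μ t`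
(with `exp (-z ∞) = 0` for `z > 0` and `exp (-0 ∞) = 1`). -/
def HasLaplaceExponent (μ : ℝ≥0 → Measure ℝ≥0∞) (G : ℝ≥0 → ℝ) : Prop :=
  ∀ t z : ℝ≥0,
    ∫⁻ x, EReal.exp (-(((z : ℝ≥0∞) * x : ℝ≥0∞) : EReal)) ∂(μ t)
      = ENNReal.ofReal (Real.exp (-((t : ℝ) * G z)))

/-- The laws `(μ t)_{t ≥ 0}` of the non-negative Lévy process that corresponds to `G`, i.e. whose
Laplace exponent is `G`.  (For `G` in `classG` they exist and are unique.) -/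
def levyLaw (G : ℝ≥0 → ℝ) : ℝ≥0 → Measure ℝ≥0∞ :=
  Classical.epsilon fun μ => IsNonnegLevyLaw μ ∧ HasLaplaceExponent μ G

/-- The Lévy-induced level function `ℓ_G(a, b) = inf {t | ℙ(X_t ≥ a) ≥ b}`, an infimum in `[0, ∞]`,
where `X` is the non-negative Lévy process that corresponds to `G`. -/
def levelFn (G : ℝ≥0 → ℝ) (a b : ℝ) : ℝ≥0∞ :=
  sInf ((fun t : ℝ≥0 => (t : ℝ≥0∞)) ''
    {t : ℝ≥0 | ENNReal.ofReal b ≤ levyLaw G t (Ici (ENNReal.ofReal a))})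

/-! ### Incremental streams and the randomness of the sketches -/

/-- The vector `x` after the first `m` updates of the stream `σ`, where the update `σ i = (v, Δ)`
sets `x v ← x v + Δ` and initially `x = 0`. -/
def vec {n : ℕ} (σ : ℕ → Fin n × ℝ≥0) (m : ℕ) (v : Fin n) : ℝ≥0 :=
  ∑ i ∈ Finset.range m, if (σ i).1 = v then (σ i).2 else 0

/-- The hash values `H v` are uniform on `[0, 1]`, the variable `Y i` generated at the `i`-th update
is `Exp(1)`, and all these variables are mutually independent. -/
structure IsRandomness {n : ℕ} {Ω : Type*} [MeasurableSpace Ω] (P : Measure Ω)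
    (H : Fin n → Ω → ℝ) (Y : ℕ → Ω → ℝ) : Prop where
  measurable_H : ∀ v, Measurable (H v)
  measurable_Y : ∀ i, Measurable (Y i)
  law_H : ∀ v, P.map (H v) = volume.restrict (Icc (0 : ℝ) 1)
  law_Y : ∀ i, P.map (Y i) = expMeasure 1
  indep : iIndepFun (Sum.elim H Y) P

/-! ### The `(G, k)`-Sampler-WOR -/

/-- The order by the second coordinate (the value `h`), ties being broken by the index. -/
def key {n : ℕ} (p : Fin n × ℝ≥0∞) : ℝ≥0∞ ×ₗ Fin n := toLex (p.2, p.1)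

/-- `kMin k L` discards every `(v, h) ∈ L` for which there is `(v, h') ∈ L` with `h' < h`, and
returns the `k` remaining elements with smallest second coordinate (all of them, if there are fewer
than `k`). -/
def kMin {n : ℕ} (k : ℕ) (L : Finset (Fin n × ℝ≥0∞)) : Finset (Fin n × ℝ≥0∞) :=
  let L' := L.filter fun p => ∀ q ∈ L, q.1 = p.1 → ¬ q.2 < p.2
  L'.filter fun p => (L'.filter fun q => key q < key p).card < k

/-- The indices that occur in `S`, listed by increasing second coordinate. -/
def report {n : ℕ} (S : Finset (Fin n × ℝ≥0∞)) : List (Fin n) :=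
  ((S.image key).sort (· ≤ ·)).map fun q => (ofLex q).2

/-- The state of the `(G, k)`-Sampler-WOR after the first `t` updates of the stream `σ`, for given
hash values `H` and given values `Y` of the exponential variables. -/
def samplerState {n : ℕ} (G : ℝ≥0 → ℝ) (k : ℕ) (σ : ℕ → Fin n × ℝ≥0)
    (H : Fin n → ℝ) (Y : ℕ → ℝ) : ℕ → Finset (Fin n × ℝ≥0∞)
  | 0 => ∅
  | t + 1 => kMin k (samplerState G k σ H Y t ∪
      {((σ t).1, levelFn G (Y t / ((σ t).2 : ℝ)) (H (σ t).1))})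

/-- Number of words of a state: two per stored pair `(v, h)`. -/
def samplerWords {n : ℕ} (S : Finset (Fin n × ℝ≥0∞)) : ℕ := 2 * S.card

/-! ### The `k`-ParetoSampler-WOR -/

/-- The minimum `k`-Pareto frontier of a set of tuples `(a, b, v)`: discard every `(a, b, v)` for
which there is `(a', b, v)` with `a' < a`, then retain the tuples that are dominated, in the first two
coordinates, by at most `k - 1` (i.e. fewer than `k`) other tuples. -/
def kPareto {n : ℕ} (k : ℕ) (L : Finset (ℝ × ℝ × Fin n)) : Finset (ℝ × ℝ × Fin n) :=
  let L' := L.filter fun p => ∀ q ∈ L, q.2 = p.2 → ¬ q.1 < p.1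
  L'.filter fun p =>
    (L'.filter fun q => q ≠ p ∧ q.1 ≤ p.1 ∧ q.2.1 ≤ p.2.1).card < k

/-- The state of the `k`-ParetoSampler-WOR after the first `t` updates of the stream `σ`. -/
def paretoState {n : ℕ} (k : ℕ) (σ : ℕ → Fin n × ℝ≥0)
    (H : Fin n → ℝ) (Y : ℕ → ℝ) : ℕ → Finset (ℝ × ℝ × Fin n)
  | 0 => ∅
  | t + 1 => kPareto k (paretoState k σ H Y t ∪
      {(Y t / ((σ t).2 : ℝ), H (σ t).1, (σ t).1)})

/-- Number of words of a state: three per stored tuple `(a, b, v)`. -/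
def paretoWords {n : ℕ} (S : Finset (ℝ × ℝ × Fin n)) : ℕ := 3 * S.card

/-- The query with `G`: the level function of `G` is evaluated on the stored tuples, and the `k`
indices of smallest level are reported in increasing order of their levels. -/
def paretoQuery {n : ℕ} (k : ℕ) (S : Finset (ℝ × ℝ × Fin n)) (G : ℝ≥0 → ℝ) : List (Fin n) :=
  report (kMin k (S.image fun p => (p.2.2, levelFn G p.1 p.2.1)))

/-! ### The target distribution -/

/-- `∏_{i=1}^k G(x(v^i)) / (G(x) - ∑_{j<i} G(x(v^j)))`, where `G(x) = ∑_u G(x(u))`. -/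
def worProb {n k : ℕ} (G : ℝ≥0 → ℝ) (x : Fin n → ℝ≥0) (v : Fin k → Fin n) : ℝ :=
  ∏ i : Fin k, G (x (v i)) / ((∑ u : Fin n, G (x u)) - ∑ j ∈ Finset.Iio i, G (x (v j)))

end GSampling

end

/-! Law of the output. For an updated index `v`, the minimum `A` of its values `Y/Δ` is exponential
with rate `x(v)` and independent of `H(v)`. As `ℓ_G` is monotone, the smallest level generated for
`v` is `ℓ_G(A, H(v))`. Up to a limit in `t`, it exceeds `t` when `P(X_t ≥ A) < H(v)`; averaging over
the uniform `H(v)` and then over `A` gives `P(X_t < A) = E exp(-x(v) X_t) = exp(-t G(x(v)))`, see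
`measure_lt_levelFn`. Hence, once some weight is positive, the levels of the updated indices are
independent exponential variables with rates `G(x(v))`, and (*) is the law of the first `k` arrivals
in an exponential race, `measure_listsFirst`. The laws of `X_t` are picked by choice, so their
existence has to be proved: drift, killing and countably many compound Poisson laws are convolved,
and uniqueness of Laplace transforms yields the semigroup property (`exists_levyLaw`).

States. `kMin` and `kPareto` are instances of one `frontier`, which does not change when elements
outside of it are deleted (`frontier_eq_of_subset`). A state is therefore the frontier of everything
generated so far, for the Pareto sampler provided that the hash values are distinct. One Pareto
frontier serves all `G`, because `ℓ_G` is monotone in both arguments: without ties, a tuple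
dominated by `k` others has `k` smaller levels below its own (`kMin_image_kPareto`).

Memory. Fix the first coordinates and remove the index with the largest hash value. It lies on the
frontier only if fewer than `k` others have a first coordinate at most its own, which holds for at
most `k` indices. Among `j` indices each is equally likely to be the largest, so `E exp(size)` grows
by a factor of at most `1 + (e - 1) k / j`; the product of these factors is at most `exp((e - 1) k
(1 + log n))` (`lintegral_frontierExp_le`, `sizeFactor_le`). Markov's inequality and a union bound
over the times finish the proof. -/

noncomputable section

namespace GSampling

/-! ### Frontiers of finite sets -/

section Frontier

open Classical in
/-- The elements of `L` that no element of `L` refines. -/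
def refined {α : Type*} (ref : α → α → Prop) (L : Finset α) : Finset α :=
  L.filter fun p => ∀ q ∈ L, ¬ ref q p

open Classical in
/-- The elements that are not refined, and are dominated by fewer than `k` such elements. -/
def frontier {α : Type*} (ref dom : α → α → Prop) (k : ℕ) (L : Finset α) : Finset α :=
  (refined ref L).filter fun p => ((refined ref L).filter fun q => dom q p).card < k

variable {α : Type*} {ref dom : α → α → Prop} {k : ℕ}

/-- The conditions on a set of items under which frontiers may be computed incrementally:
refinement and domination are strict orders, and elements with a common refinement
are comparable under refinement. -/
structure FrontierOrder (ref dom : α → α → Prop) (T : Set α) : Prop where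
  ref_dom : ∀ {p q}, ref p q → dom p q
  ref_trans : ∀ {p q r}, ref p q → ref q r → ref p r
  dom_irrefl : ∀ p, ¬ dom p p
  dom_trans : ∀ {p q r}, p ∈ T → q ∈ T → r ∈ T → dom p q → dom q r → dom p r
  ref_total : ∀ {p q r}, q ∈ T → r ∈ T → ref p q → ref p r → q = r ∨ ref q r ∨ ref r q

namespace FrontierOrder

variable {T : Set α}

lemma frontier_subset (L : Finset α) : frontier ref dom k L ⊆ L := by
  classical
  exact (Finset.filter_subset _ _).trans (Finset.filter_subset _ _)

/-- Every element is refined by, or equal to, one that is not refined. -/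
lemma exists_refined {L : Finset α} (h : FrontierOrder ref dom (L : Set α)) {p : α} (hp : p ∈ L) :
    ∃ q ∈ refined ref L, q = p ∨ ref q p := by
  classical
  -- Induction on the number of refinements: a refinement of `p` has strictly fewer of them than
  -- `p`.
  have key : ∀ N : ℕ, ∀ p ∈ L, (L.filter fun q => ref q p).card ≤ N →
      ∃ q ∈ refined ref L, q = p ∨ ref q p := by
    intro N
    induction N with
    | zero =>
      intro p hp hc
      refine ⟨p, ?_, Or.inl rfl⟩
      rw [Nat.le_zero, Finset.card_eq_zero, Finset.filter_eq_empty_iff] at hc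
      rw [refined, Finset.mem_filter]
      exact ⟨hp, fun q hq => hc hq⟩
    | succ N ih =>
      intro p hp hc
      by_cases hr : ∃ r ∈ L, ref r p
      · obtain ⟨r, hrL, hrp⟩ := hr
        have hlt : (L.filter fun q => ref q r).card < (L.filter fun q => ref q p).card := by
          refine Finset.card_lt_card (Finset.ssubset_iff_of_subset ?_ |>.2
            ⟨r, Finset.mem_filter.2 ⟨hrL, hrp⟩, ?_⟩)
          · intro x hx
            rw [Finset.mem_filter] at hx ⊢
            exact ⟨hx.1, h.ref_trans hx.2 hrp⟩
          · intro hx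
            exact h.dom_irrefl r (h.ref_dom (Finset.mem_filter.1 hx).2)
        obtain ⟨q, hq, hqr⟩ := ih r hrL (by omega)
        refine ⟨q, hq, Or.inr ?_⟩
        rcases hqr with rfl | hqr
        · exact hrp
        · exact h.ref_trans hqr hrp
      · push Not at hr
        exact ⟨p, by rw [refined, Finset.mem_filter]; exact ⟨hp, hr⟩, Or.inl rfl⟩
  exact key _ p hp le_rfl

open Classical in
/-- A dominated element is dominated by as many elements of the frontier as needed. -/
lemma le_card_frontier {L : Finset α} (h : FrontierOrder ref dom (L : Set α)) {p : α} (hp : p ∈ L)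
    (hk : k ≤ ((refined ref L).filter fun q => dom q p).card) :
    k ≤ ((frontier ref dom k L).filter fun q => dom q p).card := by
  have hsub : ∀ {x}, x ∈ refined ref L → x ∈ L := fun hx => (Finset.mem_filter.1 hx).1
  have key : ∀ N : ℕ, ∀ p ∈ L, ((refined ref L).filter fun q => dom q p).card ≤ N →
      k ≤ ((refined ref L).filter fun q => dom q p).card →
      k ≤ ((frontier ref dom k L).filter fun q => dom q p).card := by
    intro N
    induction N with
    | zero => intro p hp hc hk; omega
    | succ N ih =>
      intro p hp hc hk
      -- If a dominator `r` of `p` itself has `k` dominators, pass to `r`, which has fewer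
      -- dominators than `p`; otherwise every dominator of `p` already lies in the frontier.
      by_cases hr : ∃ r ∈ (refined ref L).filter (fun q => dom q p),
          k ≤ ((refined ref L).filter fun q => dom q r).card
      · obtain ⟨r, hr, hkr⟩ := hr
        rw [Finset.mem_filter] at hr
        have hlt : ((refined ref L).filter fun q => dom q r).card
            < ((refined ref L).filter fun q => dom q p).card := by
          refine Finset.card_lt_card (Finset.ssubset_iff_of_subset ?_ |>.2
            ⟨r, Finset.mem_filter.2 hr, ?_⟩)
          · intro x hx
            rw [Finset.mem_filter] at hx ⊢
            exact ⟨hx.1, h.dom_trans (hsub hx.1) (hsub hr.1) hp hx.2 hr.2⟩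
          · intro hx
            exact h.dom_irrefl r (Finset.mem_filter.1 hx).2
        refine (ih r (hsub hr.1) (by omega) hkr).trans (Finset.card_le_card ?_)
        intro x hx
        rw [Finset.mem_filter] at hx ⊢
        exact ⟨hx.1, h.dom_trans (frontier_subset L hx.1) (hsub hr.1) hp hx.2 hr.2⟩
      · push Not at hr
        refine hk.trans (Finset.card_le_card ?_)
        intro x hx
        have hx' := Finset.mem_filter.1 hx
        exact Finset.mem_filter.2 ⟨Finset.mem_filter.2 ⟨hx'.1, hr x hx⟩, hx'.2⟩
  exact key _ p hp le_rfl hk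

/-- The frontier does not change when elements outside of it are removed. -/
lemma frontier_eq_of_subset {L M : Finset α} (h : FrontierOrder ref dom (L : Set α))
    (hFM : frontier ref dom k L ⊆ M) (hML : M ⊆ L) :
    frontier ref dom k M = frontier ref dom k L := by
  classical
  have hsub : ∀ {x}, x ∈ refined ref L → x ∈ L := fun hx => (Finset.mem_filter.1 hx).1
  have hFM' : frontier ref dom k L ⊆ refined ref M := by
    intro x hx
    refine Finset.mem_filter.2 ⟨hFM hx, fun q hq => ?_⟩
    exact (Finset.mem_filter.1 (Finset.mem_filter.1 hx).1).2 q (hML hq)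
  -- If `p` is refined in `L` but not in `M`, its unrefined refinement `q` cannot be in the
  -- frontier, which is part of `M`. So `q` has `k` dominators in the frontier, and these dominate
  -- `p` too.
  have hlarge : ∀ p ∈ M, p ∈ refined ref M → p ∉ frontier ref dom k L →
      k ≤ ((frontier ref dom k L).filter fun q => dom q p).card := by
    intro p hpM hpM' hpF
    by_cases hpL : p ∈ refined ref L
    · refine h.le_card_frontier (hML hpM) ?_
      by_contra hlt
      exact hpF (Finset.mem_filter.2 ⟨hpL, not_le.1 hlt⟩)
    · obtain ⟨q, hq, hqp⟩ := h.exists_refined (hML hpM)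
      rcases hqp with rfl | hqp
      · exact absurd hq hpL
      have hqF : q ∉ frontier ref dom k L := fun hqF =>
        (Finset.mem_filter.1 hpM').2 q (hFM hqF) hqp
      have : k ≤ ((frontier ref dom k L).filter fun r => dom r q).card := by
        refine h.le_card_frontier (hsub hq) ?_
        by_contra hlt
        exact hqF (Finset.mem_filter.2 ⟨hq, not_le.1 hlt⟩)
      refine this.trans (Finset.card_le_card ?_)
      intro x hx
      rw [Finset.mem_filter] at hx ⊢
      exact ⟨hx.1, h.dom_trans (frontier_subset L hx.1) (hsub hq) (hML hpM) hx.2 (h.ref_dom hqp)⟩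
  ext p
  constructor
  · intro hp
    have hp' := Finset.mem_filter.1 hp
    have hpM : p ∈ M := (Finset.mem_filter.1 hp'.1).1
    by_contra hpF
    have h1 := hlarge p hpM hp'.1 hpF
    have h2 : ((frontier ref dom k L).filter fun q => dom q p).card
        ≤ ((refined ref M).filter fun q => dom q p).card :=
      Finset.card_le_card (Finset.filter_subset_filter _ hFM')
    exact absurd hp'.2 (not_lt.2 (h1.trans h2))
  · intro hp
    have hp' := Finset.mem_filter.1 hp
    refine Finset.mem_filter.2 ⟨hFM' hp, lt_of_le_of_lt (Finset.card_le_card ?_) hp'.2⟩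
    intro q hq
    rw [Finset.mem_filter] at hq ⊢
    refine ⟨?_, hq.2⟩
    have hqM : q ∈ M := (Finset.mem_filter.1 hq.1).1
    -- A dominator `q` of `p` that is unrefined only in `M` would bring `k` dominators of its own,
    -- all of which dominate `p`; but `p` has fewer than `k`.
    by_contra hqL
    have h1 := hlarge q hqM hq.1 fun hqF => hqL (Finset.mem_filter.1 hqF).1
    have h2 : ((frontier ref dom k L).filter fun r => dom r q).card
        ≤ ((refined ref L).filter fun r => dom r p).card := by
      refine Finset.card_le_card ?_
      intro x hx
      rw [Finset.mem_filter] at hx ⊢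
      exact ⟨(Finset.mem_filter.1 hx.1).1,
        h.dom_trans (frontier_subset L hx.1) (hML hqM) (hsub hp'.1) hx.2 hq.2⟩
    exact absurd hp'.2 (not_lt.2 (h1.trans h2))

/-- Frontiers are computed incrementally. -/
lemma frontier_frontier_union [DecidableEq α] {S : Finset α} {p : α}
    (h : FrontierOrder ref dom ((S ∪ {p} : Finset α) : Set α)) :
    frontier ref dom k (frontier ref dom k S ∪ {p}) = frontier ref dom k (S ∪ {p}) := by
  classical
  by_cases hpS : p ∈ S
  · have hS : S ∪ {p} = S := Finset.union_eq_left.2 (Finset.singleton_subset_iff.2 hpS)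
    rw [hS] at h ⊢
    exact h.frontier_eq_of_subset Finset.subset_union_left
      (Finset.union_subset (frontier_subset S) (Finset.singleton_subset_iff.2 hpS))
  have hST : S ⊆ S ∪ {p} := Finset.subset_union_left
  have hpT : p ∈ S ∪ {p} := Finset.mem_union_right _ (Finset.mem_singleton_self p)
  refine h.frontier_eq_of_subset ?_ (Finset.union_subset_union_left (frontier_subset S))
  intro x hx
  have hx' := Finset.mem_filter.1 hx
  have hxr := Finset.mem_filter.1 hx'.1
  rcases Finset.mem_union.1 hxr.1 with hxS | hxp
  swap
  · exact Finset.mem_union_right _ hxp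
  refine Finset.mem_union_left _ (Finset.mem_filter.2
    ⟨Finset.mem_filter.2 ⟨hxS, fun q hq => hxr.2 q (hST hq)⟩, lt_of_le_of_lt ?_ hx'.2⟩)
  -- The new element `p` may refine a dominator `q` of `x`, but then it dominates `x` in place of
  -- `q`. By `ref_total` at most one unrefined `q` is replaced, and `p ∉ S` excludes a collision
  -- with an old element.
  refine Finset.card_le_card_of_injOn (fun q => if ref p q then p else q) ?_ ?_
  · intro q hq
    have hq' := Finset.mem_filter.1 hq
    have hqr := Finset.mem_filter.1 hq'.1
    by_cases hpq : ref p q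
    · simp only [hpq, if_true]
      refine Finset.mem_coe.2 (Finset.mem_filter.2 ⟨Finset.mem_filter.2 ⟨hpT, fun r hr hrp => ?_⟩,
        h.dom_trans hpT (hST hqr.1) (hST hxS) (h.ref_dom hpq) hq'.2⟩)
      rcases Finset.mem_union.1 hr with hrS | hrp'
      · exact hqr.2 r hrS (h.ref_trans hrp hpq)
      · rw [Finset.mem_singleton.1 hrp'] at hrp
        exact h.dom_irrefl p (h.ref_dom hrp)
    · simp only [hpq, if_false]
      refine Finset.mem_coe.2 (Finset.mem_filter.2
        ⟨Finset.mem_filter.2 ⟨hST hqr.1, fun r hr hrq => ?_⟩, hq'.2⟩)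
      rcases Finset.mem_union.1 hr with hrS | hrp'
      · exact hqr.2 r hrS hrq
      · rw [Finset.mem_singleton.1 hrp'] at hrq
        exact hpq hrq
  · intro q hq r hr hqr
    have hq' := Finset.mem_filter.1 (Finset.mem_filter.1 (Finset.mem_coe.1 hq)).1
    have hr' := Finset.mem_filter.1 (Finset.mem_filter.1 (Finset.mem_coe.1 hr)).1
    by_cases hpq : ref p q <;> by_cases hpr : ref p r <;> simp only [hpq, hpr, if_true, if_false] at hqr
    · rcases h.ref_total (hST hq'.1) (hST hr'.1) hpq hpr with e | e | e
      · exact e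
      · exact absurd e (hr'.2 q hq'.1)
      · exact absurd e (hq'.2 r hr'.1)
    · exact absurd (hqr ▸ hr'.1) hpS
    · exact absurd (hqr ▸ hq'.1) hpS
    · exact hqr

end FrontierOrder

end Frontier

/-! ### The states of the two samplers -/

section States

variable {n : ℕ}

lemma kMin_eq_frontier (k : ℕ) (L : Finset (Fin n × ℝ≥0∞)) :
    kMin k L = frontier (fun q p => q.1 = p.1 ∧ q.2 < p.2) (fun q p => key q < key p) k L := by
  classical
  simp only [kMin, frontier, refined, not_and]

lemma kPareto_eq_frontier (k : ℕ) (L : Finset (ℝ × ℝ × Fin n)) :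
    kPareto k L = frontier (fun q p => q.2 = p.2 ∧ q.1 < p.1)
      (fun q p => q ≠ p ∧ q.1 ≤ p.1 ∧ q.2.1 ≤ p.2.1) k L := by
  classical
  simp only [kPareto, frontier, refined, not_and]

lemma key_injective : Function.Injective (key (n := n)) := by
  intro p q h
  have := toLex.injective h
  simp only [Prod.mk.injEq] at this
  exact Prod.ext this.2 this.1

lemma key_lt_key_of_lt {p q : Fin n × ℝ≥0∞} (h : p.2 < q.2) : key p < key q :=
  Prod.Lex.toLex_lt_toLex.2 (Or.inl h)

lemma snd_le_of_key_lt {p q : Fin n × ℝ≥0∞} (h : key p < key q) : p.2 ≤ q.2 := by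
  rcases Prod.Lex.toLex_lt_toLex.1 h with h | h
  · exact h.le
  · exact h.1.le

lemma kMin_frontierOrder (T : Set (Fin n × ℝ≥0∞)) :
    FrontierOrder (fun q p : Fin n × ℝ≥0∞ => q.1 = p.1 ∧ q.2 < p.2)
      (fun q p => key q < key p) T where
  ref_dom h := key_lt_key_of_lt h.2
  ref_trans h h' := ⟨h.1.trans h'.1, h.2.trans h'.2⟩
  dom_irrefl p := lt_irrefl _
  dom_trans _ _ _ h h' := h.trans h'
  ref_total {p q r} _ _ h h' := by
    have e : q.1 = r.1 := h.1.symm.trans h'.1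
    rcases lt_trichotomy q.2 r.2 with l | l | l
    · exact Or.inr (Or.inl ⟨e, l⟩)
    · exact Or.inl (Prod.ext e l)
    · exact Or.inr (Or.inr ⟨e.symm, l⟩)

/-- Domination uses weak inequalities, so two tuples with equal coordinates and different indices
would dominate each other and break transitivity. Distinct hash values exclude this. -/
lemma kPareto_frontierOrder {T : Set (ℝ × ℝ × Fin n)} {H : Fin n → ℝ} (hH : Function.Injective H)
    (hT : ∀ p ∈ T, p.2.1 = H p.2.2) :
    FrontierOrder (fun q p : ℝ × ℝ × Fin n => q.2 = p.2 ∧ q.1 < p.1)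
      (fun q p => q ≠ p ∧ q.1 ≤ p.1 ∧ q.2.1 ≤ p.2.1) T where
  ref_dom h := ⟨fun e => h.2.ne (congrArg Prod.fst e), h.2.le, (congrArg Prod.fst h.1).le⟩
  ref_trans h h' := ⟨h.1.trans h'.1, h.2.trans h'.2⟩
  dom_irrefl p h := h.1 rfl
  dom_trans {p q r} hp hq hr h h' := by
    refine ⟨?_, h.2.1.trans h'.2.1, h.2.2.trans h'.2.2⟩
    rintro rfl
    have e1 : p.1 = q.1 := le_antisymm h.2.1 h'.2.1
    have e2 : p.2.1 = q.2.1 := le_antisymm h.2.2 h'.2.2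
    have e3 : p.2.2 = q.2.2 := hH (by rw [← hT p hp, ← hT q hq, e2])
    exact h.1 (Prod.ext e1 (Prod.ext e2 e3))
  ref_total {p q r} _ _ h h' := by
    have e : q.2 = r.2 := h.1.symm.trans h'.1
    rcases lt_trichotomy q.1 r.1 with l | l | l
    · exact Or.inr (Or.inl ⟨e, l⟩)
    · exact Or.inl (Prod.ext l e)
    · exact Or.inr (Or.inr ⟨e.symm, l⟩)

/-- The orders behind `kMin` are strict for every outcome, ties being broken by the index; so this
identity is deterministic, unlike its analogue for the Pareto sampler. -/
lemma samplerState_eq (G : ℝ≥0 → ℝ) (k : ℕ) (σ : ℕ → Fin n × ℝ≥0) (H : Fin n → ℝ) (Y : ℕ → ℝ)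
    (t : ℕ) :
    samplerState G k σ H Y t = kMin k ((Finset.range t).image fun i =>
      ((σ i).1, levelFn G (Y i / ((σ i).2 : ℝ)) (H (σ i).1))) := by
  induction t with
  | zero => simp [samplerState, kMin]
  | succ t ih =>
    rw [samplerState, ih, Finset.range_add_one, Finset.image_insert, Finset.insert_eq,
      Finset.union_comm {_}]
    simp only [kMin_eq_frontier]
    exact (kMin_frontierOrder _).frontier_frontier_union

lemma paretoState_eq (k : ℕ) (σ : ℕ → Fin n × ℝ≥0) {H : Fin n → ℝ} (hH : Function.Injective H)
    (Y : ℕ → ℝ) (t : ℕ) :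
    paretoState k σ H Y t = kPareto k ((Finset.range t).image fun i =>
      (Y i / ((σ i).2 : ℝ), H (σ i).1, (σ i).1)) := by
  induction t with
  | zero => simp [paretoState, kPareto]
  | succ t ih =>
    rw [paretoState, ih, Finset.range_add_one, Finset.image_insert, Finset.insert_eq,
      Finset.union_comm {_}]
    simp only [kPareto_eq_frontier]
    refine (kPareto_frontierOrder hH ?_).frontier_frontier_union
    intro p hp
    simp only [Finset.coe_union, Finset.coe_image, Finset.coe_singleton, Set.mem_union,
      Set.mem_image, Set.mem_singleton_iff] at hp
    rcases hp with ⟨i, -, rfl⟩ | rfl <;> rfl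

end States

/-! ### The reported list -/

section Report

variable {n : ℕ}

/-- The entries of `l` have increasing values `T`, and the other members of `V` have larger ones. -/
def ListsFirst {ι R : Type*} [LT R] (T : ι → R) (l : List ι) (V : Finset ι) : Prop :=
  l.Pairwise (fun u v => T u < T v) ∧ ∀ v ∈ l, ∀ u ∈ V, u ∉ l → T v < T u

/-- The pairs `(v, ℓ v)` for `v ∈ V`. -/
def levelPairs (V : Finset (Fin n)) (ℓ : Fin n → ℝ≥0∞) : Finset (Fin n × ℝ≥0∞) :=
  V.image fun v => (v, ℓ v)

lemma mem_levelPairs {V : Finset (Fin n)} {ℓ : Fin n → ℝ≥0∞} {p : Fin n × ℝ≥0∞} :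
    p ∈ levelPairs V ℓ ↔ p.1 ∈ V ∧ p.2 = ℓ p.1 := by
  rw [levelPairs, Finset.mem_image]
  constructor
  · rintro ⟨v, hv, rfl⟩
    exact ⟨hv, rfl⟩
  · rintro ⟨h1, h2⟩
    exact ⟨p.1, h1, Prod.ext rfl h2.symm⟩

lemma mem_kMin_levelPairs {k : ℕ} {V : Finset (Fin n)} {ℓ : Fin n → ℝ≥0∞} {p : Fin n × ℝ≥0∞} :
    p ∈ kMin k (levelPairs V ℓ) ↔ p ∈ levelPairs V ℓ ∧
      ((levelPairs V ℓ).filter fun q => key q < key p).card < k := by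
  have : (levelPairs V ℓ).filter
      (fun p => ∀ q ∈ levelPairs V ℓ, q.1 = p.1 → ¬ q.2 < p.2) = levelPairs V ℓ := by
    refine Finset.filter_true_of_mem fun p hp q hq h => ?_
    rw [(mem_levelPairs.1 hp).2, (mem_levelPairs.1 hq).2, h]
    exact lt_irrefl _
  rw [kMin, this, Finset.mem_filter]

lemma card_levelPairs (V : Finset (Fin n)) (ℓ : Fin n → ℝ≥0∞) : (levelPairs V ℓ).card = V.card :=
  Finset.card_image_of_injective _ fun _ _ h => congrArg Prod.fst h

lemma kMin_subset (k : ℕ) (L : Finset (Fin n × ℝ≥0∞)) : kMin k L ⊆ L :=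
  (Finset.filter_subset _ _).trans (Finset.filter_subset _ _)

/-- Pairs with a level that is not minimal for their index do not matter. -/
lemma kMin_eq_kMin_levelPairs (k : ℕ) {L : Finset (Fin n × ℝ≥0∞)} {V : Finset (Fin n)}
    {ℓ : Fin n → ℝ≥0∞} (hV : ∀ v ∈ V, (v, ℓ v) ∈ L) (hL : ∀ p ∈ L, p.1 ∈ V ∧ ℓ p.1 ≤ p.2) :
    kMin k L = kMin k (levelPairs V ℓ) := by
  rw [kMin_eq_frontier, kMin_eq_frontier]
  refine ((kMin_frontierOrder _).frontier_eq_of_subset ?_ ?_).symm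
  · rw [← kMin_eq_frontier]
    intro p hp
    have hp' := Finset.mem_filter.1 (Finset.mem_filter.1 hp).1
    have h := hL p hp'.1
    exact mem_levelPairs.2 ⟨h.1, le_antisymm (not_lt.1 (hp'.2 _ (hV _ h.1) rfl)) h.2⟩
  · intro p hp
    have h := mem_levelPairs.1 hp
    have := hV _ h.1
    rwa [← h.2] at this

lemma kMin_levelPairs_eq_of_subset {k : ℕ} {V : Finset (Fin n)} {ℓ : Fin n → ℝ≥0∞}
    {M : Finset (Fin n × ℝ≥0∞)} (h : kMin k (levelPairs V ℓ) ⊆ M) (hM : M ⊆ levelPairs V ℓ) :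
    kMin k M = kMin k (levelPairs V ℓ) := by
  rw [kMin_eq_frontier] at h ⊢
  rw [kMin_eq_frontier]
  exact (kMin_frontierOrder _).frontier_eq_of_subset h hM

/-- All other members lie below the one with the largest key, and fewer than `k` do. -/
lemma card_kMin_le (k : ℕ) (L : Finset (Fin n × ℝ≥0∞)) : (kMin k L).card ≤ k := by
  rcases (kMin k L).eq_empty_or_nonempty with h | h
  · simp [h]
  obtain ⟨p, hp, hmax⟩ := Finset.exists_max_image (kMin k L) key h
  have hp' := (Finset.mem_filter.1 hp).2
  have : (kMin k L).card - 1 < k := by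
    rw [← Finset.card_erase_of_mem hp]
    refine lt_of_le_of_lt (Finset.card_le_card ?_) hp'
    intro q hq
    rw [Finset.mem_erase] at hq
    exact Finset.mem_filter.2 ⟨(Finset.mem_filter.1 hq.2).1,
      lt_of_le_of_ne (hmax q hq.2) fun e => hq.1 (key_injective e)⟩
  omega

/-- If some pair has at least `k` pairs below it, take the least such pair: everything below it is
kept. -/
lemma card_kMin_levelPairs {k : ℕ} {V : Finset (Fin n)} (hk : k ≤ V.card) (ℓ : Fin n → ℝ≥0∞) :
    (kMin k (levelPairs V ℓ)).card = k := by
  refine le_antisymm (card_kMin_le k _) ?_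
  by_cases h : ∃ p ∈ levelPairs V ℓ, k ≤ ((levelPairs V ℓ).filter fun q => key q < key p).card
  swap
  · push Not at h
    have : kMin k (levelPairs V ℓ) = levelPairs V ℓ :=
      (kMin_subset _ _).antisymm fun p hp => mem_kMin_levelPairs.2 ⟨hp, h p hp⟩
    rw [this, card_levelPairs]
    exact hk
  obtain ⟨p, hp, hmin⟩ := Finset.exists_min_image
    ((levelPairs V ℓ).filter fun p => k ≤ ((levelPairs V ℓ).filter fun q => key q < key p).card)
    key (by obtain ⟨p, h1, h2⟩ := h; exact ⟨p, Finset.mem_filter.2 ⟨h1, h2⟩⟩)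
  rw [Finset.mem_filter] at hp
  refine hp.2.trans (Finset.card_le_card fun q hq => ?_)
  rw [Finset.mem_filter] at hq
  refine mem_kMin_levelPairs.2 ⟨hq.1, ?_⟩
  by_contra hlt
  exact absurd (hmin q (Finset.mem_filter.2 ⟨hq.1, not_lt.1 hlt⟩)) (not_le.2 hq.2)

lemma length_report (S : Finset (Fin n × ℝ≥0∞)) : (report S).length = S.card := by
  rw [report, List.length_map, Finset.length_sort, Finset.card_image_of_injective _ key_injective]

/-- A list whose pairs are sorted by level is what is reported. -/
lemma report_image_toFinset {ℓ : Fin n → ℝ≥0∞} {l : List (Fin n)}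
    (hl : l.Pairwise fun u v => ℓ u < ℓ v) :
    report (levelPairs l.toFinset ℓ) = l := by
  have hpw : (l.map fun v => key (v, ℓ v)).Pairwise (· < ·) := by
    rw [List.pairwise_map]
    exact hl.imp fun h => key_lt_key_of_lt h
  have e : (levelPairs l.toFinset ℓ).image key = (l.map fun v => key (v, ℓ v)).toFinset := by
    ext q
    simp [levelPairs]
  rw [report, e, (List.toFinset_sort (· ≤ ·) (hpw.imp ne_of_lt)).2 (hpw.imp le_of_lt),
    List.map_map]
  exact List.map_id l

lemma sort_eq_map_report {S : Finset (Fin n × ℝ≥0∞)} {ℓ : Fin n → ℝ≥0∞}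
    (hS : ∀ p ∈ S, p.2 = ℓ p.1) :
    (S.image key).sort (· ≤ ·) = (report S).map fun v => key (v, ℓ v) := by
  rw [report, List.map_map]
  refine (List.map_id _).symm.trans (List.map_congr_left fun q hq => ?_)
  rw [Finset.mem_sort, Finset.mem_image] at hq
  obtain ⟨p, hp, rfl⟩ := hq
  simp only [id, Function.comp, key, ofLex_toLex, hS p hp]

lemma mem_report {S : Finset (Fin n × ℝ≥0∞)} {ℓ : Fin n → ℝ≥0∞}
    (hS : ∀ p ∈ S, p.2 = ℓ p.1) {v : Fin n} : v ∈ report S ↔ (v, ℓ v) ∈ S := by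
  rw [report, List.mem_map]
  simp only [Finset.mem_sort, Finset.mem_image]
  constructor
  · rintro ⟨_, ⟨p, hp, rfl⟩, rfl⟩
    have : (p.1, ℓ p.1) = p := Prod.ext rfl (hS p hp).symm
    simpa [key, this] using hp
  · intro h
    exact ⟨_, ⟨_, h, rfl⟩, rfl⟩

lemma pairwise_report {S : Finset (Fin n × ℝ≥0∞)} {ℓ : Fin n → ℝ≥0∞}
    (hS : ∀ p ∈ S, p.2 = ℓ p.1) :
    (report S).Pairwise fun u v => key (u, ℓ u) < key (v, ℓ v) := by
  have h := Finset.sortedLT_sort (S.image key)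
  rw [sort_eq_map_report hS] at h
  exact List.pairwise_map.1 h.pairwise

lemma nodup_report {S : Finset (Fin n × ℝ≥0∞)} {ℓ : Fin n → ℝ≥0∞}
    (hS : ∀ p ∈ S, p.2 = ℓ p.1) : (report S).Nodup :=
  (pairwise_report hS).imp fun h e => by simp [e] at h

lemma snd_eq_of_mem_kMin {k : ℕ} {V : Finset (Fin n)} {ℓ : Fin n → ℝ≥0∞} :
    ∀ p ∈ kMin k (levelPairs V ℓ), p.2 = ℓ p.1 :=
  fun _ hp => (mem_levelPairs.1 (kMin_subset _ _ hp)).2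

/-- Without ties the order of the keys is the order of the levels. In the converse direction, the
`k` pairs of `l` all belong to `kMin`, which has at most `k` members. -/
lemma report_kMin_eq_iff {k : ℕ} {V : Finset (Fin n)} {ℓ : Fin n → ℝ≥0∞}
    (hinj : Set.InjOn ℓ V) {l : List (Fin n)} (hl : l.Nodup) (hlk : l.length = k) :
    report (kMin k (levelPairs V ℓ)) = l ↔ (∀ v ∈ l, v ∈ V) ∧ ListsFirst ℓ l V := by
  constructor
  · rintro rfl
    have hS : ∀ p ∈ kMin k (levelPairs V ℓ), p.2 = ℓ p.1 := snd_eq_of_mem_kMin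
    have hmem : ∀ v ∈ report (kMin k (levelPairs V ℓ)), v ∈ V := fun v hv =>
      (mem_levelPairs.1 (kMin_subset _ _ ((mem_report hS).1 hv))).1
    refine ⟨hmem, ?_, ?_⟩
    · refine (pairwise_report hS).imp_of_mem fun {u v} hu hv h => ?_
      refine lt_of_le_of_ne (snd_le_of_key_lt h) fun e => ?_
      rw [hinj (hmem u hu) (hmem v hv) e] at h
      exact lt_irrefl _ h
    · intro v hv u hu hul
      by_contra hle
      have hlt : ℓ u < ℓ v := lt_of_le_of_ne (not_lt.1 hle) fun e =>
        hul (hinj hu (hmem v hv) e ▸ hv)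
      refine hul ((mem_report hS).2 (mem_kMin_levelPairs.2 ⟨mem_levelPairs.2 ⟨hu, rfl⟩, ?_⟩))
      refine lt_of_le_of_lt (Finset.card_le_card ?_)
        (mem_kMin_levelPairs.1 ((mem_report hS).1 hv)).2
      intro q hq
      rw [Finset.mem_filter] at hq ⊢
      exact ⟨hq.1, hq.2.trans (key_lt_key_of_lt hlt)⟩
  · rintro ⟨hlV, hpw, hlt⟩
    have hcard : (levelPairs l.toFinset ℓ).card = k := by
      rw [card_levelPairs, List.toFinset_card_of_nodup hl, hlk]
    have : kMin k (levelPairs V ℓ) = levelPairs l.toFinset ℓ := by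
      refine (Finset.eq_of_subset_of_card_le (fun p hp => ?_) ?_).symm
      · rw [mem_levelPairs, List.mem_toFinset] at hp
        refine mem_kMin_levelPairs.2 ⟨mem_levelPairs.2 ⟨hlV _ hp.1, hp.2⟩, ?_⟩
        have hpl : p ∈ levelPairs l.toFinset ℓ := by rwa [mem_levelPairs, List.mem_toFinset]
        rw [← hcard, ← Finset.card_erase_add_one hpl, Nat.lt_add_one_iff]
        refine Finset.card_le_card fun q hq => ?_
        rw [Finset.mem_filter, mem_levelPairs] at hq
        refine Finset.mem_erase.2 ⟨fun e => ?_, mem_levelPairs.2 ⟨?_, hq.1.2⟩⟩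
        · rw [e] at hq
          exact lt_irrefl _ hq.2
        · rw [List.mem_toFinset]
          by_contra hql
          have h1 := hlt p.1 hp.1 q.1 hq.1.1 hql
          rw [← hp.2, ← hq.1.2] at h1
          exact absurd (snd_le_of_key_lt hq.2) (not_le.2 h1)
      · rw [hcard]
        exact card_kMin_le k _
    rw [this, report_image_toFinset hpw]

/-! ### The tuples kept by the Pareto sampler -/

/-- The tuples `(A v, H v, v)` for `v ∈ V`. -/
def paretoTuples (V : Finset (Fin n)) (A H : Fin n → ℝ) : Finset (ℝ × ℝ × Fin n) :=
  V.image fun v => (A v, H v, v)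

/-- Tuples with a first coordinate that is not minimal for their index do not matter. -/
lemma kPareto_eq_kPareto_paretoTuples (k : ℕ) {L : Finset (ℝ × ℝ × Fin n)} {V : Finset (Fin n)}
    {A H : Fin n → ℝ} (hH : Function.Injective H) (hV : ∀ v ∈ V, (A v, H v, v) ∈ L)
    (hL : ∀ p ∈ L, p.2.2 ∈ V ∧ p.2.1 = H p.2.2 ∧ A p.2.2 ≤ p.1) :
    kPareto k L = kPareto k (paretoTuples V A H) := by
  rw [kPareto_eq_frontier, kPareto_eq_frontier]
  refine ((kPareto_frontierOrder hH fun p hp => (hL p hp).2.1).frontier_eq_of_subset ?_ ?_).symm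
  · rw [← kPareto_eq_frontier]
    intro p hp
    have hp' := Finset.mem_filter.1 (Finset.mem_filter.1 hp).1
    obtain ⟨h1, h2, h3⟩ := hL p hp'.1
    have h4 := hp'.2 _ (hV _ h1) (Prod.ext h2.symm rfl)
    exact Finset.mem_image.2 ⟨p.2.2, h1,
      Prod.ext (le_antisymm h3 (not_lt.1 h4)) (Prod.ext h2.symm rfl)⟩
  · intro p hp
    obtain ⟨v, hv, rfl⟩ := Finset.mem_image.1 hp
    exact hV v hv

lemma mem_kPareto_paretoTuples {k : ℕ} {V : Finset (Fin n)} {A H : Fin n → ℝ}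
    {p : ℝ × ℝ × Fin n} :
    p ∈ kPareto k (paretoTuples V A H) ↔ ∃ v ∈ V, (A v, H v, v) = p ∧
      (V.filter fun u => u ≠ v ∧ A u ≤ A v ∧ H u ≤ H v).card < k := by
  have e : (paretoTuples V A H).filter
      (fun p => ∀ q ∈ paretoTuples V A H, q.2 = p.2 → ¬ q.1 < p.1) = paretoTuples V A H := by
    refine Finset.filter_true_of_mem fun p hp q hq h => ?_
    obtain ⟨v, -, rfl⟩ := Finset.mem_image.1 hp
    obtain ⟨u, -, rfl⟩ := Finset.mem_image.1 hq
    have : u = v := congrArg Prod.snd h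
    rw [this]
    exact lt_irrefl _
  have hinj : Function.Injective fun v : Fin n => (A v, H v, v) :=
    fun _ _ h => congrArg (fun p : ℝ × ℝ × Fin n => p.2.2) h
  have hc : ∀ v, ((paretoTuples V A H).filter fun q =>
      q ≠ (A v, H v, v) ∧ q.1 ≤ A v ∧ q.2.1 ≤ H v).card
      = (V.filter fun u => u ≠ v ∧ A u ≤ A v ∧ H u ≤ H v).card := by
    intro v
    rw [paretoTuples, Finset.filter_image, Finset.card_image_of_injective _ hinj]
    congr 1
    refine Finset.filter_congr fun u _ => ?_
    rw [ne_eq, ne_eq, ← hinj.eq_iff]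
  rw [kPareto, e, Finset.mem_filter]
  constructor
  · rintro ⟨hp, hk⟩
    obtain ⟨v, hv, rfl⟩ := Finset.mem_image.1 hp
    exact ⟨v, hv, rfl, by rwa [← hc]⟩
  · rintro ⟨v, hv, rfl, hk⟩
    exact ⟨Finset.mem_image_of_mem _ hv, by rwa [hc]⟩

/-- The number of members of `s` that are dominated by fewer than `k` others. -/
def frontierCard {ι : Type*} (k : ℕ) (A H : ι → ℝ) (s : Finset ι) : ℕ :=
  open Classical in
  (s.filter fun v => (s.filter fun u => u ≠ v ∧ A u ≤ A v ∧ H u ≤ H v).card < k).card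

lemma card_kPareto_paretoTuples_le (k : ℕ) (V : Finset (Fin n)) (A H : Fin n → ℝ) :
    (kPareto k (paretoTuples V A H)).card ≤ frontierCard k A H V := by
  classical
  have : kPareto k (paretoTuples V A H) ⊆ (V.filter fun v =>
      (V.filter fun u => u ≠ v ∧ A u ≤ A v ∧ H u ≤ H v).card < k).image
        fun v => (A v, H v, v) := by
    intro p hp
    obtain ⟨v, hv, rfl, hk⟩ := mem_kPareto_paretoTuples.1 hp
    exact Finset.mem_image_of_mem _ (Finset.mem_filter.2 ⟨hv, hk⟩)
  refine (Finset.card_le_card this).trans (Finset.card_image_le.trans (le_of_eq ?_))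
  unfold frontierCard
  congr!

/-- The tuples of a frontier suffice for the query with every monotone level function
without ties. -/
lemma kMin_image_kPareto {k : ℕ} {V : Finset (Fin n)} {A H : Fin n → ℝ} {f : ℝ → ℝ → ℝ≥0∞}
    (hf : ∀ {a a' b b'}, a ≤ a' → b ≤ b' → f a b ≤ f a' b')
    (hinj : Set.InjOn (fun v => f (A v) (H v)) V) :
    kMin k ((kPareto k (paretoTuples V A H)).image fun p => (p.2.2, f p.1 p.2.1))
      = kMin k (levelPairs V fun v => f (A v) (H v)) := by
  refine kMin_levelPairs_eq_of_subset (fun p hp => ?_) fun p hp => ?_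
  · rw [mem_kMin_levelPairs, mem_levelPairs] at hp
    refine Finset.mem_image.2 ⟨(A p.1, H p.1, p.1), mem_kPareto_paretoTuples.2
      ⟨p.1, hp.1.1, rfl, lt_of_le_of_lt ?_ hp.2⟩, Prod.ext rfl hp.1.2.symm⟩
    -- Dominators have weakly smaller levels by monotonicity and strictly smaller ones by
    -- injectivity, so a pair among the `k` smallest has fewer than `k` dominators.
    refine Finset.card_le_card_of_injOn (fun u => (u, f (A u) (H u))) (fun u hu => ?_)
      fun _ _ _ _ h => congrArg Prod.fst h
    have hu' := Finset.mem_filter.1 (Finset.mem_coe.1 hu)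
    refine Finset.mem_coe.2 (Finset.mem_filter.2 ⟨mem_levelPairs.2 ⟨hu'.1, rfl⟩,
      key_lt_key_of_lt (lt_of_le_of_ne ?_ ?_)⟩)
    · rw [hp.1.2]
      exact hf hu'.2.2.1 hu'.2.2.2
    · rw [hp.1.2]
      exact fun e => hu'.2.1 (hinj hu'.1 hp.1.1 e)
  · obtain ⟨q, hq, rfl⟩ := Finset.mem_image.1 hp
    obtain ⟨v, hv, rfl, -⟩ := mem_kPareto_paretoTuples.1 hq
    exact mem_levelPairs.2 ⟨hv, rfl⟩

end Report

/-! ### Independence and iterated integrals -/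

section Indep

variable {Ω ι : Type*} [MeasurableSpace Ω] {P : Measure Ω}

/-- Tonelli for the joint law. The inner integral stays on `Ω`, so that estimates for `Z` as a
random variable, such as induction hypotheses, apply to it directly. -/
lemma lintegral_of_indepFun [IsProbabilityMeasure P] {α β : Type*} [MeasurableSpace α]
    [MeasurableSpace β] {X : Ω → α} {Z : Ω → β} (hX : Measurable X) (hZ : Measurable Z)
    (h : IndepFun X Z P) {F : α → β → ℝ≥0∞} (hF : Measurable (Function.uncurry F)) :
    ∫⁻ ω, F (X ω) (Z ω) ∂P = ∫⁻ x, ∫⁻ ω, F x (Z ω) ∂P ∂(P.map X) := by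
  have : IsProbabilityMeasure (P.map Z) := Measure.isProbabilityMeasure_map hZ.aemeasurable
  have h1 : ∫⁻ ω, F (X ω) (Z ω) ∂P = ∫⁻ p, Function.uncurry F p ∂(P.map fun ω => (X ω, Z ω)) := by
    rw [lintegral_map hF (hX.prodMk hZ)]
    rfl
  rw [h1, (indepFun_iff_map_prod_eq_prod_map_map hX.aemeasurable hZ.aemeasurable).1 h,
    lintegral_prod _ hF.aemeasurable]
  refine lintegral_congr fun x => ?_
  exact lintegral_map (f := fun y => F x y) (hF.comp measurable_prodMk_left) hZ

lemma measure_of_indepFun [IsProbabilityMeasure P] {α β : Type*} [MeasurableSpace α]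
    [MeasurableSpace β] {X : Ω → α} {Z : Ω → β} (hX : Measurable X) (hZ : Measurable Z)
    (h : IndepFun X Z P) {S : α → Set β} (hS : MeasurableSet {p : α × β | p.2 ∈ S p.1}) :
    P {ω | Z ω ∈ S (X ω)} = ∫⁻ x, P {ω | Z ω ∈ S x} ∂(P.map X) := by
  classical
  have := lintegral_of_indepFun (F := fun x z => (S x).indicator (fun _ => 1) z) hX hZ h
    (measurable_const.indicator hS : Measurable
      ({p : α × β | p.2 ∈ S p.1}.indicator fun _ => (1 : ℝ≥0∞)))
  have e : ∀ g : Ω → α, Measurable g → P {ω | Z ω ∈ S (g ω)}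
      = ∫⁻ ω, (S (g ω)).indicator (fun _ => 1) (Z ω) ∂P := by
    intro g hg
    exact (lintegral_indicator_one (s := {ω | Z ω ∈ S (g ω)}) ((hg.prodMk hZ) hS)).symm
  rw [e X hX, this]
  exact lintegral_congr fun x => (e (fun _ => x) measurable_const).symm

/-- Functions of disjoint finite sets of independent variables are independent. -/
lemma indepFun_of_disjoint {X : ι → Ω → ℝ} (hX : ∀ i, Measurable (X i)) (h : iIndepFun X P)
    {α β : Type*} [MeasurableSpace α] [MeasurableSpace β] {S T : Finset ι} (hST : Disjoint S T)
    {φ : (ι → ℝ) → α} {ψ : (ι → ℝ) → β} (hφ : Measurable φ) (hψ : Measurable ψ)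
    (hφS : ∀ x y, (∀ i ∈ S, x i = y i) → φ x = φ y)
    (hψT : ∀ x y, (∀ i ∈ T, x i = y i) → ψ x = ψ y) :
    IndepFun (fun ω => φ fun i => X i ω) (fun ω => ψ fun i => X i ω) P := by
  classical
  -- Vectors on `R` are extended by zero to all of `ι`; by locality of `φ` and `ψ` the added values
  -- are irrelevant.
  have hext : ∀ R : Finset ι,
      Measurable fun (z : R → ℝ) (u : ι) => if hu : u ∈ R then z ⟨u, hu⟩ else 0 := by
    intro R
    refine measurable_pi_lambda _ fun u => ?_
    by_cases hu : u ∈ R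
    · simp only [hu, dif_pos]
      exact measurable_pi_apply _
    · simp only [hu, dif_neg, not_false_eq_true]
      exact measurable_const
  convert! (h.indepFun_finset S T hST hX).comp (hφ.comp (hext S)) (hψ.comp (hext T)) using 1
  · ext1 ω
    exact hφS _ _ fun i hi => by simp [hi]
  · ext1 ω
    exact hψT _ _ fun i hi => by simp [hi]

/-- Functions of pairwise disjoint finite sets of independent variables are independent. -/
lemma iIndepFun_of_disjoint {κ : Type*} {X : ι → Ω → ℝ} (hX : ∀ i, Measurable (X i))
    (h : iIndepFun X P) {S : κ → Finset ι} (hS : Pairwise fun u v => Disjoint (S u) (S v))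
    {φ : κ → (ι → ℝ) → ℝ} (hφ : ∀ v, Measurable (φ v))
    (hφS : ∀ v x y, (∀ i ∈ S v, x i = y i) → φ v x = φ v y) :
    iIndepFun (fun v ω => φ v fun i => X i ω) P := by
  classical
  have := h.isProbabilityMeasure
  rw [iIndepFun_iff_measure_inter_preimage_eq_mul]
  intro s B hB
  induction s using Finset.induction_on with
  | empty => simp
  | insert v s hv ih =>
    rw [Finset.prod_insert hv, ← ih fun i hi => hB i (Finset.mem_insert_of_mem hi)]
    -- The variables of `s` are bundled into one vector, which depends only on the union of their
    -- coordinate sets.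
    have hind := indepFun_of_disjoint hX h (S := S v) (T := s.biUnion S)
      (φ := φ v) (ψ := fun x u => if u ∈ s then φ u x else 0)
      ((Finset.disjoint_biUnion_right _ _ _).2 fun u hu => hS fun e => hv (e ▸ hu)) (hφ v)
      (by
        refine measurable_pi_lambda _ fun u => ?_
        by_cases hu : u ∈ s
        · simpa only [hu, if_true] using hφ u
        · simp only [hu, if_false]
          exact measurable_const) (hφS v)
      (by
        intro x y hxy
        ext u
        by_cases hu : u ∈ s
        · simp only [hu, if_true]
          exact hφS u x y fun i hi => hxy i (Finset.mem_biUnion.2 ⟨u, hu, hi⟩)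
        · simp only [hu, if_false])
    have key := hind.measure_inter_preimage_eq_mul (B v) (⋂ u ∈ s, (fun z : κ → ℝ => z u) ⁻¹' B u)
      (hB v (Finset.mem_insert_self v s)) (Finset.measurableSet_biInter _ fun u hu =>
        measurable_pi_apply u (hB u (Finset.mem_insert_of_mem hu)))
    have e : (fun ω (u : κ) => if u ∈ s then φ u (fun i => X i ω) else 0) ⁻¹'
        (⋂ u ∈ s, (fun z : κ → ℝ => z u) ⁻¹' B u)
        = ⋂ u ∈ s, (fun ω => φ u fun i => X i ω) ⁻¹' B u := by
      ext ω
      simp only [mem_preimage, mem_iInter]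
      exact forall₂_congr fun u hu => by rw [if_pos hu]
    rw [e] at key
    rw [Finset.set_biInter_insert]
    exact key

/-- The subfamily remains a function on all of `ι`, zero outside `s`, so that events formulated for
such functions apply without a change of index type. -/
lemma indepFun_restrict {T : ι → Ω → ℝ} (hT : ∀ v, Measurable (T v)) (h : iIndepFun T P)
    {v : ι} {s : Finset ι} (hv : v ∉ s) [DecidableEq ι] :
    IndepFun (T v) (fun ω u => if u ∈ s then T u ω else 0) P := by
  refine indepFun_of_disjoint hT h (Finset.disjoint_singleton_left.2 hv) (φ := fun x => x v)
    (ψ := fun x u => if u ∈ s then x u else 0) (measurable_pi_apply v)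
    (measurable_pi_lambda _ fun u => ?_) (fun x y hxy => hxy v (Finset.mem_singleton_self v))
    fun x y hxy => ?_
  · by_cases hu : u ∈ s
    · simpa only [hu, if_true] using measurable_pi_apply u
    · simp only [hu, if_false]
      exact measurable_const
  · ext u
    by_cases hu : u ∈ s
    · simp only [hu, if_true, hxy u hu]
    · simp only [hu, if_false]

/-- Given `X`, the variable `Z` would have to hit a single point, which is a null set for its law.
-/
lemma measure_eq_of_indepFun [IsProbabilityMeasure P] {X Z : Ω → ℝ} (hX : Measurable X)
    (hZ : Measurable Z) (h : IndepFun X Z P) [NullSingletonClass (P.map Z)] : P {ω | Z ω = X ω} = 0 := by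
  have h1 := measure_of_indepFun hX hZ h (S := fun x => {x})
    (measurableSet_eq_fun measurable_snd measurable_fst)
  refine h1.trans ((lintegral_congr fun x => ?_).trans lintegral_zero)
  have := Measure.map_apply (μ := P) hZ (measurableSet_singleton x)
  rw [measure_singleton] at this
  exact this.symm

/-- Independent variables without atoms are almost surely distinct. -/
lemma ae_injOn_of_iIndepFun [IsProbabilityMeasure P] {T : ι → Ω → ℝ} (hT : ∀ v, Measurable (T v))
    (h : iIndepFun T P) (s : Finset ι) (hs : ∀ v ∈ s, NullSingletonClass (P.map (T v))) :
    ∀ᵐ ω ∂P, Set.InjOn (fun v => T v ω) s := by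
  have : ∀ u ∈ s, ∀ v ∈ s, ∀ᵐ ω ∂P, T u ω = T v ω → u = v := by
    intro u hu v hv
    by_cases huv : u = v
    · exact ae_of_all _ fun _ _ => huv
    have := hs u hu
    have h0 : P {ω | T u ω = T v ω} = 0 :=
      measure_eq_of_indepFun (hT v) (hT u) (h.indepFun (Ne.symm huv))
    have h1 : ∀ᵐ ω ∂P, ¬ T u ω = T v ω := by
      rw [ae_iff]
      simpa using h0
    filter_upwards [h1] with ω hω e using absurd e hω
  have h2 : ∀ᵐ ω ∂P, ∀ u ∈ s, ∀ v ∈ s, T u ω = T v ω → u = v := by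
    rw [Finset.eventually_all]
    intro u hu
    rw [Finset.eventually_all]
    exact fun v hv => this u hu v hv
  filter_upwards [h2] with ω hω u hu v hv e using hω u hu v hv e

lemma measurable_restrict {T : ι → Ω → ℝ} (hT : ∀ v, Measurable (T v)) (s : Finset ι)
    [DecidableEq ι] : Measurable fun ω u => if u ∈ s then T u ω else 0 := by
  refine measurable_pi_lambda _ fun u => ?_
  by_cases hu : u ∈ s
  · simpa only [hu, if_true] using hT u
  · simp only [hu, if_false]
    exact measurable_const

end Indep

/-! ### The order of independent exponential variables -/

section Exponential

lemma expMeasure_eq_withDensity (r : ℝ) :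
    expMeasure r = volume.withDensity (exponentialPDF r) := rfl

@[fun_prop]
lemma measurable_exponentialPDF (r : ℝ) : Measurable (exponentialPDF r) :=
  (measurable_exponentialPDFReal r).ennreal_ofReal

lemma expMeasure_Ioi {r : ℝ} (hr : 0 < r) {t : ℝ} (ht : 0 ≤ t) :
    expMeasure r (Ioi t) = ENNReal.ofReal (Real.exp (-(r * t))) := by
  have := isProbabilityMeasure_expMeasure hr
  have h1 : expMeasure r (Iic t) = ENNReal.ofReal (1 - Real.exp (-(r * t))) := by
    rw [← ofReal_cdf, cdf_expMeasure_eq hr, if_pos ht]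
  rw [← compl_Iic, prob_compl_eq_one_sub measurableSet_Iic, h1, ← ENNReal.ofReal_one,
    ← ENNReal.ofReal_sub]
  · simp
  · rw [sub_nonneg, Real.exp_le_one_iff]
    nlinarith

/-- A law on `ℝ` with exponential tails is exponential. -/
lemma eq_expMeasure {r : ℝ} (hr : 0 < r) (μ : Measure ℝ) [IsProbabilityMeasure μ]
    (h : ∀ t : ℝ, 0 ≤ t → μ (Ioi t) = ENNReal.ofReal (Real.exp (-(r * t)))) :
    μ = expMeasure r := by
  have := isProbabilityMeasure_expMeasure hr
  refine Measure.ext_of_Ici μ _ fun t => ?_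
  have key : ∀ t : ℝ, μ (Ioi t) = expMeasure r (Ioi t) := by
    intro t
    rcases le_or_gt 0 t with ht | ht
    · rw [h t ht, expMeasure_Ioi hr ht]
    · have h1 : ∀ ρ : Measure ℝ, IsProbabilityMeasure ρ → ρ (Ioi 0) = 1 → ρ (Ioi t) = 1 := by
        intro ρ _ h0
        exact le_antisymm prob_le_one (h0 ▸ measure_mono (Ioi_subset_Ioi ht.le))
      rw [h1 μ inferInstance (by simp [h 0 le_rfl]),
        h1 (expMeasure r) inferInstance (by simp [expMeasure_Ioi hr le_rfl])]
  have hlim : ∀ ρ : Measure ℝ, IsProbabilityMeasure ρ →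
      ρ (Ici t) = ⨅ k : ℕ, ρ (Ioi (t - 1 / ((k : ℝ) + 1))) := by
    intro ρ _
    have hI : Ici t = ⋂ k : ℕ, Ioi (t - 1 / ((k : ℝ) + 1)) := by
      ext x
      simp only [mem_Ici, mem_iInter, mem_Ioi]
      constructor
      · intro hx k
        have : (0 : ℝ) < 1 / ((k : ℝ) + 1) := by positivity
        linarith
      · intro hx
        by_contra hlt
        obtain ⟨k, hk⟩ := exists_nat_one_div_lt (sub_pos.2 (not_le.1 hlt))
        have := hx k
        linarith
    rw [hI]
    refine Antitone.measure_iInter (fun i j hij => Ioi_subset_Ioi ?_)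
      (fun _ => measurableSet_Ioi.nullMeasurableSet) ⟨0, measure_ne_top _ _⟩
    have : 1 / ((j : ℝ) + 1) ≤ 1 / ((i : ℝ) + 1) := by
      apply one_div_le_one_div_of_le (by positivity)
      exact_mod_cast Nat.succ_le_succ hij
    linarith
  rw [hlim μ inferInstance, hlim (expMeasure r) inferInstance]
  exact iInf_congr fun k => key _

/-- The integrand of the race: the density of the first arrival times the survival probability of
the others is `r / (r + s)` times the density of rate `r + s`. -/
lemma exponentialPDF_mul_ofReal_exp {r s c x : ℝ} (hr : 0 < r) (hs : 0 ≤ s) (hx : 0 ≤ x) :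
    exponentialPDF r x * ENNReal.ofReal (Real.exp (-(s * x)) * c)
      = ENNReal.ofReal (r / (r + s) * c) * exponentialPDF (r + s) x := by
  rw [exponentialPDF_of_nonneg hx, exponentialPDF_of_nonneg hx,
    ← ENNReal.ofReal_mul (by positivity), mul_comm (ENNReal.ofReal (r / (r + s) * c)),
    ← ENNReal.ofReal_mul (by positivity)]
  congr 1
  have : Real.exp (-((r + s) * x)) = Real.exp (-(r * x)) * Real.exp (-(s * x)) := by
    rw [← Real.exp_add]
    ring_nf
  rw [this]
  field_simp

variable {Ω ι : Type*}

/-- `∏ r(l_i) / (R - ∑_{j < i} r(l_j))`. -/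
def worList (r : ι → ℝ) : List ι → ℝ → ℝ
  | [], _ => 1
  | v :: l, R => r v / R * worList r l (R - r v)

lemma measurableSet_listsFirst (l : List ι) (s : Finset ι) :
    MeasurableSet {z : ι → ℝ | ListsFirst z l s} := by
  classical
  have h1 : MeasurableSet {z : ι → ℝ | l.Pairwise fun u v => z u < z v} := by
    induction l with
    | nil => simp
    | cons v l ih =>
      simp only [List.pairwise_cons, Set.ofPred_and]
      refine MeasurableSet.inter ?_ ih
      have : {z : ι → ℝ | ∀ u ∈ l, z v < z u} = ⋂ u ∈ {u | u ∈ l}, {z : ι → ℝ | z v < z u} := by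
        ext z; simp
      rw [this]
      exact MeasurableSet.biInter (List.finite_toSet l).countable fun u _ =>
        measurableSet_lt (measurable_pi_apply v) (measurable_pi_apply u)
  have h2 : {z : ι → ℝ | ListsFirst z l s} = {z : ι → ℝ | l.Pairwise fun u v => z u < z v} ∩
      ⋂ v ∈ {v | v ∈ l}, ⋂ u ∈ {u | u ∈ s ∧ u ∉ l}, {z : ι → ℝ | z v < z u} := by
    ext z
    simp only [ListsFirst, mem_inter_iff, mem_iInter, mem_ofPred_eq, and_imp]
  rw [h2]
  refine h1.inter (MeasurableSet.biInter (List.finite_toSet l).countable fun v _ =>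
    MeasurableSet.biInter (s.finite_toSet.subset fun u hu => hu.1).countable fun u _ =>
      measurableSet_lt (measurable_pi_apply v) (measurable_pi_apply u))

/-- The recursion for the race: once `v` has arrived first, the others run the same race with
threshold `T v` in place of `t`. -/
lemma listsFirst_cons_iff [DecidableEq ι] {T : ι → ℝ} {v : ι} {l : List ι} {s : Finset ι} {t : ℝ}
    (hl : (v :: l).Nodup) (hs : ∀ u ∈ v :: l, u ∈ s) :
    ((∀ u ∈ s, t < T u) ∧ ListsFirst T (v :: l) s) ↔
      t < T v ∧ (∀ u ∈ s.erase v, T v < T u) ∧ ListsFirst T l (s.erase v) := by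
  have hvl : v ∉ l := (List.nodup_cons.1 hl).1
  have hvs : v ∈ s := hs v List.mem_cons_self
  simp only [ListsFirst, List.pairwise_cons, List.mem_cons, forall_eq_or_imp, not_or,
    Finset.mem_erase]
  constructor
  · rintro ⟨h1, ⟨h2, h3⟩, h4, h5⟩
    refine ⟨h1 v hvs, fun u hu => ?_, h3, fun w hw u hu hul => h5 w hw u hu.2 ⟨hu.1, hul⟩⟩
    by_cases hul : u ∈ l
    · exact h2 u hul
    · exact h4 u hu.2 ⟨hu.1, hul⟩
  · rintro ⟨h1, h2, h3, h4⟩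
    refine ⟨fun u hu => ?_, ⟨fun u hu => ?_, h3⟩, fun u hu hul => h2 u ⟨hul.1, hu⟩,
      fun w hw u hu hul => h4 w hw u ⟨hul.1, hu⟩ hul.2⟩
    · by_cases huv : u = v
      · rwa [huv]
      · exact h1.trans (h2 u ⟨huv, hu⟩)
    · exact h2 u ⟨fun e => hvl (e ▸ hu), hs u (List.mem_cons_of_mem _ hu)⟩

lemma listsFirst_congr {T T' : ι → ℝ} {l : List ι} {s : Finset ι} (hs : ∀ u ∈ l, u ∈ s)
    (h : ∀ u ∈ s, T u = T' u) : ListsFirst T l s ↔ ListsFirst T' l s := by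
  have h1 : ∀ {T T' : ι → ℝ}, (∀ u ∈ s, T u = T' u) → ListsFirst T l s → ListsFirst T' l s := by
    rintro T T' h ⟨h1, h2⟩
    refine ⟨h1.imp_of_mem fun hu hv hlt => ?_, fun v hv u hu hul => ?_⟩
    · rwa [← h _ (hs _ hu), ← h _ (hs _ hv)]
    · rw [← h _ (hs _ hv), ← h _ hu]
      exact h2 v hv u hu hul
  exact ⟨h1 h, h1 fun u hu => (h u hu).symm⟩

/-- The law of the first members in the order of independent exponential variables. -/
theorem measure_listsFirst [MeasurableSpace Ω] {P : Measure Ω} [IsProbabilityMeasure P]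
    {T : ι → Ω → ℝ} (hT : ∀ v, Measurable (T v)) (hind : iIndepFun T P) {r : ι → ℝ}
    (l : List ι) (hl : l.Nodup) (s : Finset ι) (hls : ∀ u ∈ l, u ∈ s) (hr : ∀ v ∈ s, 0 < r v)
    (hlaw : ∀ v ∈ s, P.map (T v) = expMeasure (r v)) (t : ℝ) (ht : 0 ≤ t) :
    P {ω | (∀ u ∈ s, t < T u ω) ∧ ListsFirst (fun u => T u ω) l s}
      = ENNReal.ofReal (Real.exp (-((∑ u ∈ s, r u) * t)) * worList r l (∑ u ∈ s, r u)) := by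
  classical
  -- The threshold `t` must vary: after conditioning on the time `x` of the first arrival, the
  -- induction hypothesis is used with threshold `x`.
  induction l generalizing s t with
  | nil =>
    have e : {ω | (∀ u ∈ s, t < T u ω) ∧ ListsFirst (fun u => T u ω) [] s}
        = ⋂ u ∈ s, T u ⁻¹' Ioi t := by
      ext ω; simp [ListsFirst]
    rw [e, hind.measure_inter_preimage_eq_mul s (fun _ _ => measurableSet_Ioi), worList, mul_one,
      Finset.sum_mul, ← Finset.sum_neg_distrib, Real.exp_sum,
      ENNReal.ofReal_prod_of_nonneg fun _ _ => (Real.exp_pos _).le]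
    refine Finset.prod_congr rfl fun u hu => ?_
    rw [← Measure.map_apply (hT u) measurableSet_Ioi, hlaw u hu, expMeasure_Ioi (hr u hu) ht]
  | cons v l ih =>
    have hvs : v ∈ s := hls v List.mem_cons_self
    have hvl : v ∉ l := (List.nodup_cons.1 hl).1
    have hls' : ∀ u ∈ l, u ∈ s.erase v := fun u hu =>
      Finset.mem_erase.2 ⟨fun e => hvl (e ▸ hu), hls u (List.mem_cons_of_mem _ hu)⟩
    set Z : Ω → ι → ℝ := fun ω u => if u ∈ s.erase v then T u ω else 0 with hZ
    have hZT : ∀ ω, ∀ u ∈ s.erase v, Z ω u = T u ω := fun ω u hu => if_pos hu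
    set S : ℝ → Set (ι → ℝ) := fun x => {z | t < x ∧ (∀ u ∈ s.erase v, x < z u) ∧
      ListsFirst z l (s.erase v)} with hS
    have e : ∀ x ω, Z ω ∈ S x ↔ (t < x ∧ (∀ u ∈ s.erase v, x < T u ω) ∧
        ListsFirst (fun u => T u ω) l (s.erase v)) := by
      intro x ω
      simp only [hS, mem_ofPred_eq]
      rw [listsFirst_congr hls' (hZT ω)]
      refine and_congr_right fun _ => and_congr_left fun _ => forall₂_congr fun u hu => ?_
      rw [hZT ω u hu]
    have e1 : {ω | (∀ u ∈ s, t < T u ω) ∧ ListsFirst (fun u => T u ω) (v :: l) s}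
        = {ω | Z ω ∈ S (T v ω)} := by
      ext ω
      rw [mem_ofPred_eq, mem_ofPred_eq, e, listsFirst_cons_iff hl hls]
    have hSm : MeasurableSet {p : ℝ × (ι → ℝ) | p.2 ∈ S p.1} := by
      have : {p : ℝ × (ι → ℝ) | p.2 ∈ S p.1} = Prod.fst ⁻¹' Ioi t ∩
          ((⋂ u ∈ s.erase v, {p : ℝ × (ι → ℝ) | p.1 < p.2 u}) ∩
            Prod.snd ⁻¹' {z : ι → ℝ | ListsFirst z l (s.erase v)}) := by
        ext p
        simp only [hS, mem_ofPred_eq, mem_inter_iff, mem_preimage, mem_Ioi, mem_iInter]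
      rw [this]
      exact (measurable_fst measurableSet_Ioi).inter (MeasurableSet.inter
        (Finset.measurableSet_biInter _ fun u _ => measurableSet_lt measurable_fst
          ((measurable_pi_apply u).comp measurable_snd))
        (measurable_snd (measurableSet_listsFirst l _)))
    rw [e1, measure_of_indepFun (hT v) (measurable_restrict hT _)
      (indepFun_restrict hT hind (Finset.notMem_erase v s)) hSm, hlaw v hvs]
    set R' := ∑ u ∈ s.erase v, r u with hR'
    have hR : ∑ u ∈ s, r u = r v + R' := (Finset.add_sum_erase s r hvs).symm
    have hR'0 : 0 ≤ R' := Finset.sum_nonneg fun u hu => (hr u (Finset.mem_of_mem_erase hu)).le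
    have hin : ∀ x, P {ω | Z ω ∈ S x} = (Ioi t).indicator
        (fun x => ENNReal.ofReal (Real.exp (-(R' * x)) * worList r l R')) x := by
      intro x
      by_cases hx : t < x
      · rw [indicator_of_mem (mem_Ioi.2 hx), ← ih (List.nodup_cons.1 hl).2 (s.erase v) hls'
          (fun u hu => hr u (Finset.mem_of_mem_erase hu))
          (fun u hu => hlaw u (Finset.mem_of_mem_erase hu)) x (ht.trans hx.le)]
        congr 1
        ext ω
        exact (e x ω).trans (and_iff_right hx)
      · rw [indicator_of_notMem (by simpa using hx)]
        convert measure_empty (μ := P)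
        ext ω
        exact iff_of_false (fun h => hx ((e x ω).1 h).1) (notMem_empty ω)
    rw [lintegral_congr hin, lintegral_indicator measurableSet_Ioi, expMeasure_eq_withDensity,
      setLIntegral_withDensity_eq_setLIntegral_mul _ (measurable_exponentialPDF _) (by fun_prop)
        measurableSet_Ioi]
    have : ∀ x ∈ Ioi t, (exponentialPDF (r v) * fun x => ENNReal.ofReal
        (Real.exp (-(R' * x)) * worList r l R')) x
        = ENNReal.ofReal (r v / (r v + R') * worList r l R') * exponentialPDF (r v + R') x :=
      fun x hx => exponentialPDF_mul_ofReal_exp (hr v hvs) hR'0 (ht.trans (le_of_lt hx))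
    rw [setLIntegral_congr_fun measurableSet_Ioi this,
      lintegral_const_mul _ (measurable_exponentialPDF _),
      ← withDensity_apply _ measurableSet_Ioi, ← expMeasure_eq_withDensity,
      expMeasure_Ioi (add_pos_of_pos_of_nonneg (hr v hvs) hR'0) ht, hR, worList,
      add_sub_cancel_left, ← ENNReal.ofReal_mul' (Real.exp_pos _).le, mul_comm]

lemma worList_ofFn {n : ℕ} (r : Fin n → ℝ) {k : ℕ} (v : Fin k → Fin n) (R : ℝ) :
    worList r (List.ofFn v) R = ∏ i : Fin k, r (v i) / (R - ∑ j ∈ Finset.Iio i, r (v j)) := by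
  induction k generalizing R with
  | zero => simp [worList]
  | succ k ih =>
    rw [List.ofFn_succ, worList, ih, Fin.prod_univ_succ]
    congr 1
    · have : Finset.Iio (0 : Fin (k + 1)) = ∅ := by
        ext j; simp
      rw [this, Finset.sum_empty, sub_zero]
    · refine Finset.prod_congr rfl fun i _ => ?_
      have : Finset.Iio i.succ = insert 0 ((Finset.Iio i).map (Fin.succEmb k)) := by
        ext j
        refine Fin.cases ?_ (fun j => ?_) j
        · simp
        · simp
      rw [this, Finset.sum_insert (by simp), Finset.sum_map, sub_sub]
      rfl

end Exponential

/-! ### Laplace transforms of measures on `[0, ∞]` -/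

section Laplace

/-- `exp (-x)` for `x` in `[0, ∞]`. -/
def expNeg (x : ℝ≥0∞) : ℝ≥0∞ := EReal.exp (-(x : EReal))

lemma continuous_expNeg : Continuous expNeg :=
  ENNReal.continuous_exp.comp (continuous_neg.comp continuous_coe_ennreal_ereal)

@[fun_prop]
lemma measurable_expNeg : Measurable expNeg := continuous_expNeg.measurable

@[simp]
lemma expNeg_zero : expNeg 0 = 1 := by simp [expNeg]

@[simp]
lemma expNeg_top : expNeg ⊤ = 0 := by simp [expNeg]

lemma expNeg_add (x y : ℝ≥0∞) : expNeg (x + y) = expNeg x * expNeg y := by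
  rw [expNeg, EReal.coe_ennreal_add, EReal.neg_add (Or.inl (EReal.coe_ennreal_ne_bot x))
    (Or.inr (EReal.coe_ennreal_ne_bot y)), sub_eq_add_neg, EReal.exp_add]
  rfl

lemma expNeg_strictAnti : StrictAnti expNeg := fun _ _ h =>
  EReal.exp_strictMono (EReal.neg_lt_neg_iff.2 (EReal.coe_ennreal_lt_coe_ennreal_iff.2 h))

lemma expNeg_le_one (x : ℝ≥0∞) : expNeg x ≤ 1 :=
  expNeg_zero ▸ expNeg_strictAnti.antitone (zero_le (a := x))

lemma expNeg_ofReal {r : ℝ} (hr : 0 ≤ r) :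
    expNeg (ENNReal.ofReal r) = ENNReal.ofReal (Real.exp (-r)) := by
  rw [expNeg, EReal.coe_ennreal_ofReal, max_eq_left hr, ← EReal.coe_neg, EReal.exp_coe]

lemma expNeg_natCast_mul (j : ℕ) (x : ℝ≥0∞) : expNeg (j * x) = expNeg x ^ j := by
  induction j with
  | zero => simp
  | succ j ih => rw [Nat.cast_succ, add_mul, one_mul, expNeg_add, ih, pow_succ]

lemma expNeg_sum {ι : Type*} (s : Finset ι) (f : ι → ℝ≥0∞) :
    expNeg (∑ i ∈ s, f i) = ∏ i ∈ s, expNeg (f i) := by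
  classical
  induction s using Finset.induction_on with
  | empty => simp
  | insert i s hi ih => rw [Finset.sum_insert hi, Finset.prod_insert hi, expNeg_add, ih]

/-- The Laplace transform. -/
def laplace (μ : Measure ℝ≥0∞) (z : ℝ≥0) : ℝ≥0∞ := ∫⁻ x, expNeg (z * x) ∂μ

lemma measurable_expNeg_mul (z : ℝ≥0) : Measurable fun x : ℝ≥0∞ => expNeg (z * x) := by fun_prop

lemma hasLaplaceExponent_iff {μ : ℝ≥0 → Measure ℝ≥0∞} {G : ℝ≥0 → ℝ} :
    HasLaplaceExponent μ G ↔
      ∀ t z : ℝ≥0, laplace (μ t) z = ENNReal.ofReal (Real.exp (-((t : ℝ) * G z))) := Iff.rfl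

lemma laplace_zero (μ : Measure ℝ≥0∞) : laplace μ 0 = μ univ := by simp [laplace]

lemma laplace_le (μ : Measure ℝ≥0∞) (z : ℝ≥0) : laplace μ z ≤ μ univ := by
  calc laplace μ z ≤ ∫⁻ _, 1 ∂μ := lintegral_mono fun x => expNeg_le_one _
    _ = μ univ := by simp

lemma laplace_dirac (a : ℝ≥0∞) (z : ℝ≥0) : laplace (Measure.dirac a) z = expNeg (z * a) :=
  lintegral_dirac' _ (measurable_expNeg_mul z)

lemma laplace_conv (μ ν : Measure ℝ≥0∞) [SFinite ν] (z : ℝ≥0) :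
    laplace (Measure.conv μ ν) z = laplace μ z * laplace ν z := by
  rw [laplace, Measure.lintegral_conv (measurable_expNeg_mul z)]
  simp only [mul_add, expNeg_add]
  simp only [lintegral_const_mul _ (measurable_expNeg_mul z)]
  rw [lintegral_mul_const _ (measurable_expNeg_mul z)]
  rfl

/-- `exp (-x)` as a bounded continuous function on `[0, ∞]`. -/
def expNegBCF : BoundedContinuousFunction ℝ≥0∞ ℝ :=
  BoundedContinuousFunction.mkOfCompact
    ⟨fun x => (expNeg x).toReal, ENNReal.continuousOn_toReal.comp_continuous continuous_expNeg
      fun x => ((expNeg_le_one x).trans_lt ENNReal.one_lt_top).ne⟩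

lemma expNegBCF_apply (x : ℝ≥0∞) : expNegBCF x = (expNeg x).toReal := rfl

/-- The polynomials in `exp (-x)`. -/
def expNegAlgebra : StarSubalgebra ℝ (BoundedContinuousFunction ℝ≥0∞ ℝ) where
  toSubalgebra := Algebra.adjoin ℝ {expNegBCF}
  star_mem' {f} hf := by
    have : star f = f := by ext x; simp
    rwa [this]

/-- Powers of `exp (-x)` integrate to Laplace transforms at integers, and only these enter the
uniqueness theorem. -/
lemma integral_expNegBCF_pow {μ : Measure ℝ≥0∞} [IsFiniteMeasure μ] (j : ℕ) :
    ∫ x, (expNegBCF ^ j) x ∂μ = (laplace μ j).toReal := by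
  have : ∀ x, (expNegBCF ^ j) x = (expNeg (((j : ℝ≥0) : ℝ≥0∞) * x)).toReal := by
    intro x
    rw [BoundedContinuousFunction.coe_pow, Pi.pow_apply, expNegBCF_apply, ENNReal.coe_natCast,
      expNeg_natCast_mul, ENNReal.toReal_pow]
  simp only [this]
  rw [integral_toReal (measurable_expNeg_mul j).aemeasurable
    (ae_of_all _ fun x => (expNeg_le_one _).trans_lt ENNReal.one_lt_top)]
  rfl

/-- Finite measures on `[0, ∞]` are determined by their Laplace transforms. -/
theorem ext_of_laplace {μ ν : Measure ℝ≥0∞} [IsFiniteMeasure μ] [IsFiniteMeasure ν]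
    (h : ∀ z, laplace μ z = laplace ν z) : μ = ν := by
  -- It suffices to test against polynomials in `exp (-x)`, since this one function separates the
  -- points of `[0, ∞]`, including `∞`.
  refine ext_of_forall_mem_subalgebra_integral_eq_of_polish (A := expNegAlgebra) ?_ ?_
  · intro x y hxy
    refine ⟨expNegBCF, ⟨_, ⟨expNegBCF, Algebra.self_mem_adjoin_singleton ℝ _, rfl⟩, rfl⟩, ?_⟩
    change (expNeg x).toReal ≠ (expNeg y).toReal
    intro e
    rw [ENNReal.toReal_eq_toReal_iff' ((expNeg_le_one x).trans_lt ENNReal.one_lt_top).ne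
      ((expNeg_le_one y).trans_lt ENNReal.one_lt_top).ne] at e
    exact hxy (expNeg_strictAnti.injective e)
  · intro g hg
    have hg' : g ∈ Algebra.adjoin ℝ {expNegBCF} := hg
    rw [Algebra.adjoin_singleton_eq_range_aeval] at hg'
    obtain ⟨p, rfl⟩ := hg'
    have key : ∀ ρ : Measure ℝ≥0∞, IsFiniteMeasure ρ →
        ∫ x, (Polynomial.aeval expNegBCF p : BoundedContinuousFunction ℝ≥0∞ ℝ) x ∂ρ
          = p.sum fun j c => c * (laplace ρ j).toReal := by
      intro ρ _
      have : ∀ x, (Polynomial.aeval expNegBCF p : BoundedContinuousFunction ℝ≥0∞ ℝ) x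
          = ∑ j ∈ p.support, p.coeff j * (expNegBCF ^ j) x := by
        intro x
        rw [Polynomial.aeval_eq_sum_range, BoundedContinuousFunction.coe_sum,
          Finset.sum_apply]
        exact (Polynomial.sum_over_range p (f := fun j c => c * (expNegBCF ^ j) x)
          (by simp)).symm
      simp only [this]
      rw [integral_finsetSum _ fun j _ =>
        ((expNegBCF ^ j).integrable ρ).const_mul (p.coeff j), Polynomial.sum]
      refine Finset.sum_congr rfl fun j _ => ?_
      rw [integral_const_mul, integral_expNegBCF_pow]
    change ∫ x, (Polynomial.aeval expNegBCF p : BoundedContinuousFunction ℝ≥0∞ ℝ) x ∂μ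
      = ∫ x, (Polynomial.aeval expNegBCF p : BoundedContinuousFunction ℝ≥0∞ ℝ) x ∂ν
    rw [key μ inferInstance, key ν inferInstance]
    simp only [h]

end Laplace

/-! ### Existence of the Lévy process -/

section Existence

/-- `φ` is the negative logarithm of a Laplace transform. -/
def IsLaplaceLog (φ : ℝ≥0 → ℝ) : Prop :=
  ∃ μ : Measure ℝ≥0∞, ∀ z, laplace μ z = ENNReal.ofReal (Real.exp (-φ z))

lemma isProbabilityMeasure_of_laplace {μ : Measure ℝ≥0∞} {c : ℝ} (hc : c = 0)
    (h : laplace μ 0 = ENNReal.ofReal (Real.exp (-c))) : IsProbabilityMeasure μ :=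
  ⟨by rw [← laplace_zero, h, hc]; simp⟩

namespace IsLaplaceLog

lemma add {φ ψ : ℝ≥0 → ℝ} (hφ : IsLaplaceLog φ) (hψ : IsLaplaceLog ψ) :
    IsLaplaceLog fun z => φ z + ψ z := by
  obtain ⟨μ, hμ⟩ := hφ
  obtain ⟨ν, hν⟩ := hψ
  have : IsFiniteMeasure ν := ⟨by rw [← laplace_zero, hν]; exact ENNReal.ofReal_lt_top⟩
  refine ⟨Measure.conv μ ν, fun z => ?_⟩
  rw [laplace_conv, hμ, hν, ← ENNReal.ofReal_mul (Real.exp_pos _).le, ← Real.exp_add, neg_add]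

lemma linear (γ : ℝ≥0) : IsLaplaceLog fun z => (γ : ℝ) * z := by
  refine ⟨Measure.dirac γ, fun z => ?_⟩
  rw [laplace_dirac, ← expNeg_ofReal (by positivity), ENNReal.ofReal_mul (by positivity),
    ENNReal.ofReal_coe_nnreal, ENNReal.ofReal_coe_nnreal, mul_comm]

/-- The atom `1 - exp (-c)` at `∞` contributes fully at `z = 0` and nothing for `z > 0`, which
creates the jump. -/
lemma killing (c : ℝ≥0) : IsLaplaceLog fun z => if 0 < z then (c : ℝ) else 0 := by
  have hc : Real.exp (-(c : ℝ)) ≤ 1 := Real.exp_le_one_iff.2 (by simp)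
  refine ⟨ENNReal.ofReal (Real.exp (-c)) • Measure.dirac 0
    + ENNReal.ofReal (1 - Real.exp (-c)) • Measure.dirac ⊤, fun z => ?_⟩
  have : laplace (ENNReal.ofReal (Real.exp (-c)) • Measure.dirac 0
      + ENNReal.ofReal (1 - Real.exp (-c)) • Measure.dirac ⊤) z
      = ENNReal.ofReal (Real.exp (-c)) + ENNReal.ofReal (1 - Real.exp (-c)) * expNeg (z * ⊤) := by
    have h0 := laplace_dirac 0 z
    have h1 := laplace_dirac ⊤ z
    rw [laplace] at h0 h1 ⊢
    rw [lintegral_add_measure, lintegral_smul_measure, lintegral_smul_measure, h0, h1]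
    simp
  rw [this]
  beta_reduce
  rcases eq_or_ne z 0 with rfl | hz
  · rw [if_neg (lt_irrefl _)]
    simp only [ENNReal.coe_zero, zero_mul, expNeg_zero, mul_one, neg_zero, Real.exp_zero]
    rw [← ENNReal.ofReal_add (Real.exp_pos _).le (by linarith)]
    simp
  · rw [if_pos (pos_iff_ne_zero.2 hz), ENNReal.mul_top (by simpa using hz)]
    simp

/-- Iterated convolution. -/
def convPow (ν : Measure ℝ≥0∞) : ℕ → Measure ℝ≥0∞
  | 0 => Measure.dirac 0
  | j + 1 => Measure.conv (convPow ν j) ν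

lemma laplace_convPow (ν : Measure ℝ≥0∞) [IsFiniteMeasure ν] (z : ℝ≥0) (j : ℕ) :
    laplace (convPow ν j) z = laplace ν z ^ j := by
  induction j with
  | zero => simp [convPow, laplace_dirac]
  | succ j ih => rw [convPow, laplace_conv, ih, pow_succ]

lemma tsum_ofReal_pow_div_factorial {x : ℝ} (hx : 0 ≤ x) :
    ∑' j : ℕ, ENNReal.ofReal (x ^ j / j.factorial) = ENNReal.ofReal (Real.exp x) := by
  have h := NormedSpace.expSeries_div_hasSum_exp x
  rw [← Real.exp_eq_exp_ℝ] at h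
  rw [← h.tsum_eq, ENNReal.ofReal_tsum_of_nonneg (fun j => by positivity) h.summable]

/-- Compound Poisson laws. -/
lemma compoundPoisson (ν : Measure ℝ≥0∞) [IsFiniteMeasure ν] :
    IsLaplaceLog fun z => ν.real univ - (laplace ν z).toReal := by
  -- Poisson mixture of convolution powers. The usual factor (mass)^j is absent because `ν` is not
  -- normalized and `convPow ν j` already carries it.
  refine ⟨Measure.sum fun j : ℕ => ENNReal.ofReal (Real.exp (-ν.real univ) / j.factorial) •
    convPow ν j, fun z => ?_⟩
  have hfin : laplace ν z ≠ ⊤ := ((laplace_le ν z).trans_lt (measure_lt_top _ _)).ne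
  have h0 : laplace (Measure.sum fun j : ℕ => ENNReal.ofReal (Real.exp (-ν.real univ) / j.factorial)
      • convPow ν j) z = ∑' j : ℕ, ENNReal.ofReal (Real.exp (-ν.real univ) / j.factorial)
        * laplace ν z ^ j := by
    rw [laplace, lintegral_sum_measure]
    refine tsum_congr fun j => ?_
    rw [lintegral_smul_measure, ← laplace_convPow]
    rfl
  set L := (laplace ν z).toReal with hL
  have hL0 : 0 ≤ L := ENNReal.toReal_nonneg
  rw [h0, ← ENNReal.ofReal_toReal hfin, ← hL]
  have : ∀ j : ℕ, ENNReal.ofReal (Real.exp (-ν.real univ) / j.factorial) * ENNReal.ofReal L ^ j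
      = ENNReal.ofReal (Real.exp (-ν.real univ)) * ENNReal.ofReal (L ^ j / j.factorial) := by
    intro j
    rw [← ENNReal.ofReal_pow hL0, ← ENNReal.ofReal_mul (by positivity),
      ← ENNReal.ofReal_mul (by positivity)]
    congr 1
    ring
  simp only [this]
  rw [ENNReal.tsum_mul_left, tsum_ofReal_pow_div_factorial hL0,
    ← ENNReal.ofReal_mul (Real.exp_pos _).le, ← Real.exp_add]
  congr 2
  ring

/-- The sum of countably many independent variables. -/
lemma hasSum {φ : ℕ → ℝ≥0 → ℝ} {ψ : ℝ≥0 → ℝ} (h : ∀ j, IsLaplaceLog (φ j))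
    (h0 : ∀ j, φ j 0 = 0) (hs : ∀ z, HasSum (fun j => φ j z) (ψ z)) : IsLaplaceLog ψ := by
  choose μ hμ using h
  -- The value at `z = 0` is the total mass; masses equal to one are what the infinite product
  -- requires.
  have : ∀ j, IsProbabilityMeasure (μ j) := fun j => isProbabilityMeasure_of_laplace (h0 j) (hμ j 0)
  have hSm : Measurable fun ω : ℕ → ℝ≥0∞ => ∑' j, ω j := by fun_prop
  refine ⟨(Measure.infinitePi μ).map fun ω => ∑' j, ω j, fun z => ?_⟩
  rw [laplace, lintegral_map (measurable_expNeg_mul z) hSm]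
  have hind : iIndepFun (fun (j : ℕ) (ω : ℕ → ℝ≥0∞) => expNeg (z * ω j))
      (Measure.infinitePi μ) :=
    iIndepFun_infinitePi (X := fun _ x => expNeg (z * x)) fun _ => measurable_expNeg_mul z
  have hpart : ∀ N : ℕ, ∫⁻ ω : ℕ → ℝ≥0∞, expNeg (z * ∑ j ∈ Finset.range N, ω j)
      ∂(Measure.infinitePi μ) = ENNReal.ofReal (Real.exp (-∑ j ∈ Finset.range N, φ j z)) := by
    intro N
    simp only [Finset.mul_sum, expNeg_sum]
    rw [lintegral_prod_eq_prod_lintegral_of_indepFun _ _ hind fun j =>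
      (measurable_expNeg_mul z).comp (measurable_pi_apply j), ← Finset.sum_neg_distrib,
      Real.exp_sum, ENNReal.ofReal_prod_of_nonneg fun _ _ => (Real.exp_pos _).le]
    refine Finset.prod_congr rfl fun j _ => ?_
    rw [← hμ j z, laplace]
    have := lintegral_map (μ := Measure.infinitePi μ) (measurable_expNeg_mul z)
      (measurable_pi_apply j)
    rw [Measure.infinitePi_map_eval] at this
    exact this.symm
  have hlim : Tendsto (fun N : ℕ => ∫⁻ ω : ℕ → ℝ≥0∞, expNeg (z * ∑ j ∈ Finset.range N, ω j)
      ∂(Measure.infinitePi μ)) atTop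
      (𝓝 (∫⁻ ω : ℕ → ℝ≥0∞, expNeg (z * ∑' j, ω j) ∂(Measure.infinitePi μ))) := by
    refine tendsto_lintegral_of_dominated_convergence (fun _ => 1) (fun N => by fun_prop)
      (fun N => ae_of_all _ fun ω => expNeg_le_one _) (by simp) (ae_of_all _ fun ω => ?_)
    exact ((continuous_expNeg.comp (ENNReal.continuous_const_mul ENNReal.coe_ne_top)).tendsto _).comp
      (ENNReal.tendsto_nat_tsum ω)
  refine tendsto_nhds_unique hlim ?_
  simp only [hpart]
  exact (ENNReal.continuous_ofReal.tendsto _).comp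
    ((Real.continuous_exp.tendsto _).comp ((hs z).tendsto_sum_nat.neg))

end IsLaplaceLog

/-! ### Lévy measures as countable sums of finite measures -/

section LevyMeasure

variable {ν : Measure ℝ}

lemma one_sub_exp_nonneg {r : ℝ} (hr : 0 ≤ r) (z : ℝ≥0) : 0 ≤ 1 - Real.exp (-(r * z)) := by
  have : Real.exp (-(r * z)) ≤ 1 := Real.exp_le_one_iff.2 (by
    have : 0 ≤ r * z := by positivity
    linarith)
  linarith

lemma one_sub_exp_le {r : ℝ} (hr : 0 < r) (z : ℝ≥0) :
    1 - Real.exp (-(r * z)) ≤ max 1 (z : ℝ) * min r 1 := by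
  have h1 : 1 - Real.exp (-(r * z)) ≤ 1 := by linarith [Real.exp_pos (-(r * z))]
  have h2 : 1 - Real.exp (-(r * z)) ≤ r * z := by linarith [Real.add_one_le_exp (-(r * z))]
  rcases le_total r 1 with h | h
  · rw [min_eq_left h]
    exact h2.trans ((mul_comm _ _).trans_le (mul_le_mul_of_nonneg_right (le_max_right _ _) hr.le))
  · rw [min_eq_right h, mul_one]
    exact h1.trans (le_max_left _ _)

lemma integrable_one_sub_exp
    (hν : ∫⁻ r in Ioi (0 : ℝ), ENNReal.ofReal (min r 1) ∂ν < ∞) (z : ℝ≥0) :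
    Integrable (fun r => 1 - Real.exp (-(r * (z : ℝ)))) (ν.restrict (Ioi 0)) := by
  have hm : Integrable (fun r : ℝ => min r 1) (ν.restrict (Ioi 0)) := by
    refine (lintegral_ofReal_ne_top_iff_integrable (by fun_prop) ?_).1 hν.ne
    filter_upwards [ae_restrict_mem measurableSet_Ioi] with r hr
    exact le_min (le_of_lt hr) zero_le_one
  refine (hm.const_mul (max 1 (z : ℝ))).mono' (by fun_prop) ?_
  filter_upwards [ae_restrict_mem measurableSet_Ioi] with r hr
  rw [Real.norm_of_nonneg (one_sub_exp_nonneg (le_of_lt hr) z)]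
  exact one_sub_exp_le hr z

/-- Multiplying by the positive density `min r 1` gives a finite measure, and dividing by it again
gives back `ν` on `(0, ∞)`. -/
lemma sFinite_restrict_Ioi (hν : ∫⁻ r in Ioi (0 : ℝ), ENNReal.ofReal (min r 1) ∂ν < ∞) :
    SFinite (ν.restrict (Ioi 0)) := by
  set f : ℝ → ℝ≥0∞ := fun r => ENNReal.ofReal (min r 1) with hf
  have hfm : Measurable f := by fun_prop
  have : IsFiniteMeasure ((ν.restrict (Ioi 0)).withDensity f) := isFiniteMeasure_withDensity hν.ne
  rw [← withDensity_inv_same (μ := ν.restrict (Ioi 0)) hfm ?_ (ae_of_all _ fun r => by simp [hf])]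
  · infer_instance
  · filter_upwards [ae_restrict_mem measurableSet_Ioi] with r hr
    simpa [hf] using hr

lemma IsLaplaceLog.of_finite {ρ : Measure ℝ} [IsFiniteMeasure ρ] (hρ : ∀ᵐ r ∂ρ, 0 < r) :
    IsLaplaceLog fun z => ∫ r, (1 - Real.exp (-(r * (z : ℝ)))) ∂ρ := by
  have hL : ∀ z : ℝ≥0, laplace (ρ.map ENNReal.ofReal) z
      = ∫⁻ r, ENNReal.ofReal (Real.exp (-(r * z))) ∂ρ := by
    intro z
    rw [laplace, lintegral_map (measurable_expNeg_mul z) ENNReal.measurable_ofReal]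
    refine lintegral_congr_ae ?_
    filter_upwards [hρ] with r hr
    rw [← expNeg_ofReal (by positivity), mul_comm r, ENNReal.ofReal_mul (by positivity),
      ENNReal.ofReal_coe_nnreal]
  have hint : ∀ z : ℝ≥0, Integrable (fun r => Real.exp (-(r * (z : ℝ)))) ρ := by
    intro z
    refine (integrable_const (1 : ℝ)).mono' (by fun_prop) ?_
    filter_upwards [hρ] with r hr
    rw [Real.norm_of_nonneg (Real.exp_pos _).le]
    linarith [one_sub_exp_nonneg hr.le z]
  convert! IsLaplaceLog.compoundPoisson (ρ.map ENNReal.ofReal) using 2 with z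
  rw [integral_sub (integrable_const _) (hint z), hL,
    integral_eq_lintegral_of_nonneg_ae (ae_of_all _ fun r => (Real.exp_pos _).le) (by fun_prop)]
  congr 1
  rw [integral_const, smul_eq_mul, mul_one, map_measureReal_apply ENNReal.measurable_ofReal
    MeasurableSet.univ, preimage_univ]

/-- Cut the Lévy measure into countably many finite pieces; each gives a compound Poisson law, and
the exponents of independent summands add up. -/
lemma IsLaplaceLog.of_levyMeasure
    (hν : ∫⁻ r in Ioi (0 : ℝ), ENNReal.ofReal (min r 1) ∂ν < ∞) :
    IsLaplaceLog fun z => ∫ r in Ioi (0 : ℝ), (1 - Real.exp (-(r * (z : ℝ)))) ∂ν := by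
  have := sFinite_restrict_Ioi hν
  set ρ := ν.restrict (Ioi 0) with hρ
  have hpos : ∀ j, ∀ᵐ r ∂(sfiniteSeq ρ j), 0 < r := fun j =>
    (Measure.absolutelyContinuous_of_le (sfiniteSeq_le ρ j)) (ae_restrict_mem measurableSet_Ioi)
  refine IsLaplaceLog.hasSum (fun j => IsLaplaceLog.of_finite (hpos j)) (fun j => by simp)
    fun z => ?_
  have h := integrable_one_sub_exp hν z
  rw [← hρ] at h
  rw [← sum_sfiniteSeq ρ] at h
  have h' := hasSum_integral_measure h
  rwa [sum_sfiniteSeq ρ] at h'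

end LevyMeasure

lemma classG_zero {G : ℝ≥0 → ℝ} (hG : G ∈ classG) : G 0 = 0 := by
  obtain ⟨c, γ₀, ν, -, h⟩ := hG
  simp [h 0]

lemma classG_nonneg {G : ℝ≥0 → ℝ} (hG : G ∈ classG) (z : ℝ≥0) : 0 ≤ G z := by
  obtain ⟨c, γ₀, ν, -, h⟩ := hG
  rw [h z]
  have h1 : 0 ≤ ∫ r in Ioi (0 : ℝ), (1 - Real.exp (-(r * (z : ℝ)))) ∂ν :=
    setIntegral_nonneg measurableSet_Ioi fun r hr => one_sub_exp_nonneg (le_of_lt hr) z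
  have h2 : (0 : ℝ) ≤ if 0 < z then (c : ℝ) else 0 := by split_ifs <;> simp
  positivity

/-- A member of `classG` that is positive somewhere is positive on `(0, ∞)`. -/
lemma classG_pos {G : ℝ≥0 → ℝ} (hG : G ∈ classG) {w z : ℝ≥0} (hw : 0 < G w) (hz : 0 < z) :
    0 < G z := by
  refine lt_of_le_of_ne (classG_nonneg hG z) fun e => ?_
  obtain ⟨c, γ₀, ν, hν, h⟩ := hG
  have hz' : (0 : ℝ) < z := hz
  have h1 : 0 ≤ ∫ r in Ioi (0 : ℝ), (1 - Real.exp (-(r * (z : ℝ)))) ∂ν :=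
    setIntegral_nonneg measurableSet_Ioi fun r hr => one_sub_exp_nonneg (le_of_lt hr) z
  have h2 : 0 ≤ (γ₀ : ℝ) * z := by positivity
  have h3 : 0 ≤ (c : ℝ) := c.2
  rw [h z, if_pos hz] at e
  -- If `G z = 0`, the three nonnegative summands vanish. The integrand being strictly positive on
  -- `(0, ∞)`, `ν` vanishes there, and `G w = 0` as well.
  have hc : (c : ℝ) = 0 := by linarith
  have hγ : (γ₀ : ℝ) = 0 := by
    have : (γ₀ : ℝ) * z = 0 := by linarith
    rcases mul_eq_zero.1 this with h | h
    · exact h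
    · exact absurd h hz'.ne'
  have hI : ∫ r in Ioi (0 : ℝ), (1 - Real.exp (-(r * (z : ℝ)))) ∂ν = 0 := by linarith
  rw [integral_eq_zero_iff_of_nonneg_ae ?_ (integrable_one_sub_exp hν z)] at hI
  · have : ∀ᵐ r ∂(ν.restrict (Ioi 0)), False := by
      filter_upwards [hI, ae_restrict_mem measurableSet_Ioi] with r hr hr0
      have h4 : Real.exp (-(r * z)) < 1 := Real.exp_lt_one_iff.2 (by
        have : 0 < r * z := mul_pos hr0 hz'
        linarith)
      have h5 : 1 - Real.exp (-(r * z)) = 0 := hr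
      linarith
    have h0 : ν.restrict (Ioi 0) = 0 := by
      rw [← ae_eq_bot, ← Filter.eventually_false_iff_eq_bot]
      exact this
    rw [h w, hc, hγ, h0] at hw
    simp at hw
  · filter_upwards [ae_restrict_mem measurableSet_Ioi] with r hr
    exact one_sub_exp_nonneg (le_of_lt hr) z

/-- The class is stable under scaling: `t G` has the data `t c`, `t γ₀`, `t ν`. -/
lemma IsLaplaceLog.of_classG {G : ℝ≥0 → ℝ} (hG : G ∈ classG) (t : ℝ≥0) :
    IsLaplaceLog fun z => (t : ℝ) * G z := by
  obtain ⟨c, γ₀, ν, hν, h⟩ := hG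
  have hν' : ∫⁻ r in Ioi (0 : ℝ), ENNReal.ofReal (min r 1) ∂(t • ν) < ∞ := by
    rw [Measure.restrict_smul, lintegral_smul_measure]
    exact ENNReal.mul_lt_top ENNReal.coe_lt_top hν
  convert! ((IsLaplaceLog.killing (t * c)).add (IsLaplaceLog.linear (t * γ₀))).add
    (IsLaplaceLog.of_levyMeasure hν') using 2 with z
  rw [h z, Measure.restrict_smul, integral_smul_nnreal_measure, NNReal.smul_def, smul_eq_mul]
  push_cast
  split_ifs <;> ring

/-- Markov's inequality for `1 - exp (-x)`. -/
lemma measure_Ioi_mul_le {μ : Measure ℝ≥0∞} [IsProbabilityMeasure μ] (ε : ℝ≥0∞) :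
    (1 - expNeg ε) * μ (Ioi ε) ≤ 1 - laplace μ 1 := by
  have h1 : (1 - expNeg ε) * μ (Ioi ε) ≤ ∫⁻ x, (1 - expNeg x) ∂μ := by
    refine le_trans ?_ (mul_meas_ge_le_lintegral (by fun_prop) (1 - expNeg ε))
    gcongr
    intro x hx
    exact tsub_le_tsub_left (expNeg_strictAnti hx).le 1
  refine h1.trans (le_of_eq ?_)
  have h2 : laplace μ 1 = ∫⁻ x, expNeg x ∂μ := by simp [laplace]
  rw [lintegral_sub measurable_expNeg, h2, lintegral_one, measure_univ]
  · rw [← h2]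
    exact ((laplace_le μ 1).trans_lt (measure_lt_top _ _)).ne
  · exact ae_of_all _ expNeg_le_one

/-- The laws of the Lévy process that corresponds to `G`. -/
theorem exists_levyLaw {G : ℝ≥0 → ℝ} (hG : G ∈ classG) :
    ∃ μ, IsNonnegLevyLaw μ ∧ HasLaplaceExponent μ G := by
  -- The laws are chosen separately for each `t`; uniqueness of Laplace transforms makes them a
  -- semigroup.
  choose μ hμ using IsLaplaceLog.of_classG hG
  have hprob : ∀ t, IsProbabilityMeasure (μ t) := fun t =>
    isProbabilityMeasure_of_laplace (by simp [classG_zero hG]) (hμ t 0)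
  refine ⟨μ, ⟨hprob, ?_, fun s t => ?_, fun ε hε => ?_⟩, hasLaplaceExponent_iff.2 hμ⟩
  · refine ext_of_laplace fun z => ?_
    rw [hμ, laplace_dirac]
    simp
  · have : IsFiniteMeasure (Measure.conv (μ s) (μ t)) := by
      unfold Measure.conv
      infer_instance
    refine ext_of_laplace fun z => ?_
    rw [hμ, laplace_conv, hμ, hμ, ← ENNReal.ofReal_mul (Real.exp_pos _).le, ← Real.exp_add]
    congr 2
    push_cast
    ring
  · have hpos : 1 - expNeg ε ≠ 0 := by
      rw [ne_eq, tsub_eq_zero_iff_le, not_le, ← expNeg_zero]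
      exact expNeg_strictAnti hε
    have hfin : 1 - expNeg ε ≠ ⊤ := ENNReal.sub_ne_top ENNReal.one_ne_top
    have hle : ∀ t, μ t (Ioi ε) ≤ (1 - ENNReal.ofReal (Real.exp (-((t : ℝ) * G 1))))
        / (1 - expNeg ε) := by
      intro t
      rw [ENNReal.le_div_iff_mul_le (Or.inl hpos) (Or.inl hfin), mul_comm, ← hμ]
      exact measure_Ioi_mul_le ε
    have hlim : Tendsto (fun t : ℝ≥0 => (1 - ENNReal.ofReal (Real.exp (-((t : ℝ) * G 1))))
        / (1 - expNeg ε)) (𝓝[>] 0) (𝓝 0) := by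
      have hc : Continuous fun t : ℝ≥0 => (1 - ENNReal.ofReal (Real.exp (-((t : ℝ) * G 1))))
          / (1 - expNeg ε) := by
        refine (ENNReal.continuous_div_const _ hpos).comp ((ENNReal.continuous_sub_left
          ENNReal.one_ne_top).comp (ENNReal.continuous_ofReal.comp (by fun_prop)))
      have := hc.tendsto 0
      simp only [NNReal.coe_zero, zero_mul, neg_zero, Real.exp_zero, ENNReal.ofReal_one, tsub_self,
        ENNReal.zero_div] at this
      exact this.mono_left nhdsWithin_le_nhds
    exact tendsto_of_tendsto_of_tendsto_of_le_of_le tendsto_const_nhds hlim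
      (fun _ => zero_le) hle

/-- Everything about the chosen laws is derived from these two properties, so it does not matter
which family the choice returns. -/
lemma levyLaw_spec {G : ℝ≥0 → ℝ} (hG : G ∈ classG) :
    IsNonnegLevyLaw (levyLaw G) ∧ HasLaplaceExponent (levyLaw G) G :=
  Classical.epsilon_spec (exists_levyLaw hG)

/-- `X_{s+d}` is `X_s` plus an independent nonnegative increment. -/
lemma levyLaw_Ici_mono {G : ℝ≥0 → ℝ} (hG : G ∈ classG) (a : ℝ≥0∞) :
    Monotone fun t => levyLaw G t (Ici a) := by
  intro s t hst
  have h := (levyLaw_spec hG).1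
  have := h.isProbabilityMeasure
  obtain ⟨d, rfl⟩ := exists_add_of_le hst
  change levyLaw G s (Ici a) ≤ levyLaw G (s + d) (Ici a)
  rw [h.add, Measure.conv, Measure.map_apply (by fun_prop) measurableSet_Ici]
  calc levyLaw G s (Ici a) = ((levyLaw G s).prod (levyLaw G d)) (Ici a ×ˢ univ) := by
        rw [Measure.prod_prod, measure_univ, mul_one]
    _ ≤ _ := measure_mono fun p hp => le_add_right (mem_Ici.1 hp.1)

end Existence

/-! ### The law of the level -/

section Level

variable {G : ℝ≥0 → ℝ}

lemma levelFn_mono {a a' b b' : ℝ} (ha : a ≤ a') (hb : b ≤ b') :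
    levelFn G a b ≤ levelFn G a' b' := by
  refine sInf_le_sInf (image_mono fun t ht => ?_)
  exact (ENNReal.ofReal_le_ofReal hb).trans (le_trans ht
    (measure_mono (Ici_subset_Ici.2 (ENNReal.ofReal_le_ofReal ha))))

lemma levelFn_le {a b : ℝ} {t : ℝ≥0}
    (h : ENNReal.ofReal b ≤ levyLaw G t (Ici (ENNReal.ofReal a))) : levelFn G a b ≤ t :=
  sInf_le ⟨t, h, rfl⟩

/-- By monotonicity in `t` the set in the definition of the level is upward closed, so it contains
everything strictly above its infimum. Strictness avoids asking whether the infimum is attained. -/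
lemma ofReal_le_of_levelFn_lt (hG : G ∈ classG) {a b : ℝ} {t : ℝ≥0} (h : levelFn G a b < t) :
    ENNReal.ofReal b ≤ levyLaw G t (Ici (ENNReal.ofReal a)) := by
  obtain ⟨_, ⟨s, hs, rfl⟩, hst⟩ := sInf_lt_iff.1 h
  exact le_trans hs (levyLaw_Ici_mono hG _ (ENNReal.coe_lt_coe.1 hst).le)

lemma measurable_levyLaw_Ici (t : ℝ≥0) :
    Measurable fun a : ℝ => levyLaw G t (Ici (ENNReal.ofReal a)) :=
  Antitone.measurable fun _ _ h => measure_mono (Ici_subset_Ici.2 (ENNReal.ofReal_le_ofReal h))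

lemma measurable_levelFn (hG : G ∈ classG) : Measurable fun p : ℝ × ℝ => levelFn G p.1 p.2 := by
  refine measurable_of_Iio fun c => ?_
  have : (fun p : ℝ × ℝ => levelFn G p.1 p.2) ⁻¹' Iio c
      = ⋃ q ∈ {q : ℚ | ((Real.toNNReal q : ℝ≥0) : ℝ≥0∞) < c}, {p : ℝ × ℝ |
        ENNReal.ofReal p.2 ≤ levyLaw G (Real.toNNReal q) (Ici (ENNReal.ofReal p.1))} := by
    ext p
    simp only [mem_preimage, mem_Iio, mem_iUnion, mem_ofPred_eq, exists_prop]
    constructor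
    · intro h
      obtain ⟨q, -, h1, h2⟩ := ENNReal.lt_iff_exists_rat_btwn.1 h
      exact ⟨q, h2, ofReal_le_of_levelFn_lt hG h1⟩
    · rintro ⟨q, h1, h2⟩
      exact (levelFn_le h2).trans_lt h1
  rw [this]
  exact MeasurableSet.biUnion (Set.to_countable _) fun q _ =>
    measurableSet_le (by fun_prop) ((measurable_levyLaw_Ici _).comp measurable_fst)

lemma volume_restrict_Icc_lt {p : ℝ≥0∞} (hp : p ≤ 1) :
    volume.restrict (Icc (0 : ℝ) 1) {b | p < ENNReal.ofReal b} = 1 - p := by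
  lift p to ℝ≥0 using ne_top_of_le_ne_top ENNReal.one_ne_top hp
  have hp' : (p : ℝ) ≤ 1 := by exact_mod_cast hp
  have : {b : ℝ | (p : ℝ≥0∞) < ENNReal.ofReal b} ∩ Icc 0 1 = Ioc (p : ℝ) 1 := by
    ext b
    rw [mem_inter_iff, mem_ofPred_eq, mem_Icc, mem_Ioc, ← ENNReal.ofReal_coe_nnreal,
      ENNReal.ofReal_lt_ofReal_iff_of_nonneg p.coe_nonneg]
    exact ⟨fun h => ⟨h.1, h.2.2⟩, fun h => ⟨h.1, p.coe_nonneg.trans h.1.le, h.2⟩⟩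
  rw [Measure.restrict_apply (measurableSet_lt measurable_const ENNReal.measurable_ofReal), this,
    Real.volume_Ioc, ENNReal.ofReal_sub _ p.coe_nonneg, ENNReal.ofReal_one, ENNReal.ofReal_coe_nnreal]

lemma expMeasure_lt_ofReal {x : ℝ≥0} (hx : 0 < x) (y : ℝ≥0∞) :
    expMeasure x {a | y < ENNReal.ofReal a} = expNeg (x * y) := by
  induction y with
  | top =>
    rw [ENNReal.mul_top (by simpa using hx.ne'), expNeg_top]
    simp
  | coe y =>
    have : {a : ℝ | (y : ℝ≥0∞) < ENNReal.ofReal a} = Ioi (y : ℝ) := by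
      ext a
      rw [mem_ofPred_eq, mem_Ioi, ← ENNReal.ofReal_coe_nnreal,
        ENNReal.ofReal_lt_ofReal_iff_of_nonneg y.coe_nonneg]
    rw [this, expMeasure_Ioi (NNReal.coe_pos.2 hx) y.coe_nonneg, ← expNeg_ofReal (by positivity),
      ENNReal.ofReal_mul x.coe_nonneg, ENNReal.ofReal_coe_nnreal, ENNReal.ofReal_coe_nnreal]

/-- The link between the sketch and `G`: by Tonelli, an independent exponential variable of rate `x`
exceeds `X` with probability `E exp (-x X)`. -/
lemma lintegral_expMeasure_measure_Iio (μ : Measure ℝ≥0∞) [IsProbabilityMeasure μ] {x : ℝ≥0}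
    (hx : 0 < x) :
    ∫⁻ a, μ (Iio (ENNReal.ofReal a)) ∂(expMeasure x) = laplace μ x := by
  have := isProbabilityMeasure_expMeasure (NNReal.coe_pos.2 hx)
  have hS : MeasurableSet {p : ℝ × ℝ≥0∞ | p.2 < ENNReal.ofReal p.1} :=
    measurableSet_lt measurable_snd (by fun_prop)
  have h1 := Measure.prod_apply (μ := expMeasure x) (ν := μ) hS
  rw [Measure.prod_apply_symm hS] at h1
  refine h1.symm.trans (lintegral_congr fun y => ?_)
  exact expMeasure_lt_ofReal hx y

variable {Ω : Type*} [MeasurableSpace Ω] {P : Measure Ω} [IsProbabilityMeasure P]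

/-- Given `A = a`, the uniform `U` exceeds `P(X_t ≥ a)` with probability `P(X_t < a)`; then average
over `a`. -/
lemma measure_levyLaw_Ici_lt (hG : G ∈ classG) {A U : Ω → ℝ} (hA : Measurable A)
    (hU : Measurable U) (hind : IndepFun A U P) {x : ℝ≥0} (hx : 0 < x)
    (hAlaw : P.map A = expMeasure x) (hUlaw : P.map U = volume.restrict (Icc (0 : ℝ) 1))
    (t : ℝ≥0) :
    P {ω | levyLaw G t (Ici (ENNReal.ofReal (A ω))) < ENNReal.ofReal (U ω)}
      = ENNReal.ofReal (Real.exp (-((t : ℝ) * G x))) := by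
  have hspec := levyLaw_spec hG
  have := hspec.1.isProbabilityMeasure t
  have h1 := measure_of_indepFun hA hU hind
    (S := fun a => {b | levyLaw G t (Ici (ENNReal.ofReal a)) < ENNReal.ofReal b})
    (measurableSet_lt ((measurable_levyLaw_Ici t).comp measurable_fst)
      (ENNReal.measurable_ofReal.comp measurable_snd))
  refine h1.trans ?_
  have h2 : ∀ a : ℝ, P {ω | U ω ∈ {b | levyLaw G t (Ici (ENNReal.ofReal a)) < ENNReal.ofReal b}}
      = levyLaw G t (Iio (ENNReal.ofReal a)) := by
    intro a
    have h3 := Measure.map_apply (μ := P) hU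
      (measurableSet_lt (measurable_const (a := levyLaw G t (Ici (ENNReal.ofReal a))))
        ENNReal.measurable_ofReal)
    rw [hUlaw, volume_restrict_Icc_lt prob_le_one] at h3
    rw [← compl_Ici, prob_compl_eq_one_sub measurableSet_Ici, h3]
    rfl
  rw [lintegral_congr h2, hAlaw, lintegral_expMeasure_measure_Iio _ hx]
  exact hspec.2 t x

/-- The level is exponential with rate `G x`. -/
theorem measure_lt_levelFn (hG : G ∈ classG) {A U : Ω → ℝ} (hA : Measurable A)
    (hU : Measurable U) (hind : IndepFun A U P) {x : ℝ≥0} (hx : 0 < x)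
    (hAlaw : P.map A = expMeasure x) (hUlaw : P.map U = volume.restrict (Icc (0 : ℝ) 1))
    (t : ℝ≥0) :
    P {ω | t < levelFn G (A ω) (U ω)} = ENNReal.ofReal (Real.exp (-((t : ℝ) * G x))) := by
  have hQ := measure_levyLaw_Ici_lt hG hA hU hind hx hAlaw hUlaw
  refine le_antisymm ?_ ?_
  · rw [← hQ t]
    refine measure_mono fun ω hω => ?_
    by_contra h
    exact absurd (levelFn_le (not_lt.1 h)) (not_le.2 hω)
  -- At `t` itself the converse inclusion may fail, as the level can equal `t`. It holds for every
  -- `s > t`, and the right-hand side is continuous as `s` decreases to `t`.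
  · have h1 : ∀ᶠ s : ℝ≥0 in 𝓝[>] t, ENNReal.ofReal (Real.exp (-((s : ℝ) * G x)))
        ≤ P {ω | t < levelFn G (A ω) (U ω)} := by
      filter_upwards [self_mem_nhdsWithin] with s hs
      rw [← hQ s]
      refine measure_mono fun ω hω => ?_
      have h2 : (s : ℝ≥0∞) ≤ levelFn G (A ω) (U ω) := by
        by_contra h
        exact absurd (ofReal_le_of_levelFn_lt hG (not_le.1 h)) (not_le.2 hω)
      exact lt_of_lt_of_le (ENNReal.coe_lt_coe.2 hs) h2
    have hc : Continuous fun s : ℝ≥0 => ENNReal.ofReal (Real.exp (-((s : ℝ) * G x))) :=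
      ENNReal.continuous_ofReal.comp (by fun_prop)
    exact le_of_tendsto ((hc.tendsto t).mono_left nhdsWithin_le_nhds) h1

lemma levelFn_ne_top_ae (hG : G ∈ classG) {A U : Ω → ℝ} (hA : Measurable A)
    (hU : Measurable U) (hind : IndepFun A U P) {x : ℝ≥0} (hx : 0 < x) (hGx : 0 < G x)
    (hAlaw : P.map A = expMeasure x) (hUlaw : P.map U = volume.restrict (Icc (0 : ℝ) 1)) :
    ∀ᵐ ω ∂P, levelFn G (A ω) (U ω) ≠ ⊤ := by
  rw [ae_iff]
  have h1 : ∀ j : ℕ, P {ω | ¬ levelFn G (A ω) (U ω) ≠ ⊤}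
      ≤ ENNReal.ofReal (Real.exp (-((j : ℝ) * G x))) := by
    intro j
    have := measure_lt_levelFn hG hA hU hind hx hAlaw hUlaw j
    rw [NNReal.coe_natCast] at this
    rw [← this]
    refine measure_mono fun ω hω => ?_
    have hω' : levelFn G (A ω) (U ω) = ⊤ := not_not.1 hω
    rw [mem_ofPred_eq, hω']
    exact ENNReal.coe_lt_top
  have h2 : Tendsto (fun j : ℕ => ENNReal.ofReal (Real.exp (-((j : ℝ) * G x)))) atTop (𝓝 0) := by
    rw [← ENNReal.ofReal_zero]
    exact (ENNReal.continuous_ofReal.tendsto 0).comp (Real.tendsto_exp_neg_atTop_nhds_zero.comp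
      (tendsto_natCast_atTop_atTop.atTop_mul_const hGx))
  exact le_antisymm (ge_of_tendsto' h2 h1) (zero_le)

lemma map_toReal_levelFn (hG : G ∈ classG) {A U : Ω → ℝ} (hA : Measurable A)
    (hU : Measurable U) (hind : IndepFun A U P) {x : ℝ≥0} (hx : 0 < x) (hGx : 0 < G x)
    (hAlaw : P.map A = expMeasure x) (hUlaw : P.map U = volume.restrict (Icc (0 : ℝ) 1)) :
    P.map (fun ω => (levelFn G (A ω) (U ω)).toReal) = expMeasure (G x) := by
  have hm : Measurable fun ω => (levelFn G (A ω) (U ω)).toReal :=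
    ((measurable_levelFn hG).comp (hA.prodMk hU)).ennreal_toReal
  have := Measure.isProbabilityMeasure_map (μ := P) hm.aemeasurable
  refine eq_expMeasure hGx _ fun t ht => ?_
  lift t to ℝ≥0 using ht
  rw [Measure.map_apply hm measurableSet_Ioi, mul_comm,
    ← measure_lt_levelFn hG hA hU hind hx hAlaw hUlaw t]
  refine measure_congr ?_
  filter_upwards [levelFn_ne_top_ae hG hA hU hind hx hGx hAlaw hUlaw] with ω hω
  refine propext ?_
  change (t : ℝ) < (levelFn G (A ω) (U ω)).toReal ↔ (t : ℝ≥0∞) < levelFn G (A ω) (U ω)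
  rw [← ENNReal.toReal_lt_toReal ENNReal.coe_ne_top hω, ENNReal.coe_toReal]

end Level

/-! ### The state after a stream of updates -/

section Stream

variable {n : ℕ} {σ : ℕ → Fin n × ℝ≥0} {m : ℕ}

/-- The updates of `v` among the first `m` ones. -/
def updatesOf (σ : ℕ → Fin n × ℝ≥0) (m : ℕ) (v : Fin n) : Finset ℕ :=
  (Finset.range m).filter fun i => (σ i).1 = v

/-- The indices that occur in the first `m` updates. -/
def touched (σ : ℕ → Fin n × ℝ≥0) (m : ℕ) : Finset (Fin n) :=
  Finset.univ.filter fun v => (updatesOf σ m v).Nonempty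

/-- The minimum of the values `Y / Δ` over the updates of `v` (zero if there are none). -/
def minValue (σ : ℕ → Fin n × ℝ≥0) (m : ℕ) (v : Fin n) (Y : ℕ → ℝ) : ℝ :=
  if h : (updatesOf σ m v).Nonempty then
    (updatesOf σ m v).inf' h fun i => Y i / ((σ i).2 : ℝ) else 0

lemma mem_touched {v : Fin n} : v ∈ touched σ m ↔ (updatesOf σ m v).Nonempty := by
  simp [touched]

lemma mem_updatesOf {v : Fin n} {i : ℕ} : i ∈ updatesOf σ m v ↔ i < m ∧ (σ i).1 = v := by
  simp [updatesOf]

lemma vec_eq_sum_updatesOf (v : Fin n) : vec σ m v = ∑ i ∈ updatesOf σ m v, (σ i).2 := by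
  rw [vec, updatesOf, Finset.sum_filter]

lemma vec_pos (hσ : ∀ i, 0 < (σ i).2) {v : Fin n} (hv : v ∈ touched σ m) : 0 < vec σ m v := by
  rw [vec_eq_sum_updatesOf]
  exact Finset.sum_pos (fun i _ => hσ i) (mem_touched.1 hv)

lemma vec_eq_zero {v : Fin n} (hv : v ∉ touched σ m) : vec σ m v = 0 := by
  rw [mem_touched, Finset.not_nonempty_iff_eq_empty] at hv
  rw [vec_eq_sum_updatesOf, hv, Finset.sum_empty]

lemma minValue_le {v : Fin n} {i : ℕ} (hi : i ∈ updatesOf σ m v) (Y : ℕ → ℝ) :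
    minValue σ m v Y ≤ Y i / ((σ i).2 : ℝ) := by
  rw [minValue, dif_pos ⟨i, hi⟩]
  exact Finset.inf'_le _ hi

lemma exists_minValue_eq {v : Fin n} (hv : v ∈ touched σ m) (Y : ℕ → ℝ) :
    ∃ i ∈ updatesOf σ m v, minValue σ m v Y = Y i / ((σ i).2 : ℝ) := by
  rw [minValue, dif_pos (mem_touched.1 hv)]
  exact Finset.exists_mem_eq_inf' _ _

lemma measurable_minValue (v : Fin n) : Measurable (minValue σ m v) := by
  by_cases h : (updatesOf σ m v).Nonempty
  · refine measurable_of_Ioi fun t => ?_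
    have : minValue σ m v ⁻¹' Ioi t
        = ⋂ i ∈ updatesOf σ m v, {Y : ℕ → ℝ | t < Y i / ((σ i).2 : ℝ)} := by
      ext Y
      simp only [mem_preimage, mem_Ioi, mem_iInter, mem_ofPred_eq, minValue, dif_pos h,
        Finset.lt_inf'_iff]
    rw [this]
    exact Finset.measurableSet_biInter _ fun i _ => measurableSet_lt measurable_const
      ((measurable_pi_apply i).div_const _)
  · have : minValue σ m v = fun _ => 0 := by
      ext Y
      rw [minValue, dif_neg h]
    rw [this]
    exact measurable_const

lemma minValue_congr (v : Fin n) {Y Y' : ℕ → ℝ} (h : ∀ i ∈ updatesOf σ m v, Y i = Y' i) :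
    minValue σ m v Y = minValue σ m v Y' := by
  unfold minValue
  split_ifs with hne
  · exact Finset.inf'_congr hne rfl fun i hi => by rw [h i hi]
  · rfl

/-- The levels of the indices. -/
def level (G : ℝ≥0 → ℝ) (σ : ℕ → Fin n × ℝ≥0) (m : ℕ) (H : Fin n → ℝ) (Y : ℕ → ℝ) (v : Fin n) :
    ℝ≥0∞ :=
  levelFn G (minValue σ m v Y) (H v)

/-- As the level is monotone in its first argument, the least level of an index is attained at its
least value `Y / Δ`. -/
lemma samplerState_eq_kMin_levelPairs (G : ℝ≥0 → ℝ) (k : ℕ) (H : Fin n → ℝ) (Y : ℕ → ℝ) :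
    samplerState G k σ H Y m = kMin k (levelPairs (touched σ m) (level G σ m H Y)) := by
  rw [samplerState_eq]
  refine kMin_eq_kMin_levelPairs k (fun v hv => ?_) fun p hp => ?_
  · obtain ⟨i, hi, e⟩ := exists_minValue_eq hv Y
    rw [mem_updatesOf] at hi
    refine Finset.mem_image.2 ⟨i, Finset.mem_range.2 hi.1, ?_⟩
    rw [level, e, hi.2]
  · obtain ⟨i, hi, rfl⟩ := Finset.mem_image.1 hp
    have hi' : i ∈ updatesOf σ m (σ i).1 := mem_updatesOf.2 ⟨Finset.mem_range.1 hi, rfl⟩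
    exact ⟨mem_touched.2 ⟨i, hi'⟩, levelFn_mono (minValue_le hi' Y) le_rfl⟩

lemma paretoState_eq_kPareto_paretoTuples (k : ℕ) {H : Fin n → ℝ} (hH : Function.Injective H)
    (Y : ℕ → ℝ) :
    paretoState k σ H Y m
      = kPareto k (paretoTuples (touched σ m) (fun v => minValue σ m v Y) H) := by
  rw [paretoState_eq k σ hH]
  refine kPareto_eq_kPareto_paretoTuples k hH (fun v hv => ?_) fun p hp => ?_
  · obtain ⟨i, hi, e⟩ := exists_minValue_eq hv Y
    rw [mem_updatesOf] at hi
    refine Finset.mem_image.2 ⟨i, Finset.mem_range.2 hi.1, ?_⟩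
    rw [e, hi.2]
  · obtain ⟨i, hi, rfl⟩ := Finset.mem_image.1 hp
    have hi' : i ∈ updatesOf σ m (σ i).1 := mem_updatesOf.2 ⟨Finset.mem_range.1 hi, rfl⟩
    exact ⟨mem_touched.2 ⟨i, hi'⟩, rfl, minValue_le hi' Y⟩

lemma filter_pos_subset_touched {G : ℝ≥0 → ℝ} (hG : G ∈ classG) :
    (Finset.univ.filter fun v => 0 < G (vec σ m v)) ⊆ touched σ m := by
  intro v hv
  by_contra h
  rw [Finset.mem_filter, vec_eq_zero h, classG_zero hG] at hv
  exact lt_irrefl _ hv.2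

end Stream

/-! ### The distribution of the reported list -/

section Randomness

variable {n : ℕ} {σ : ℕ → Fin n × ℝ≥0} {m : ℕ} {Ω : Type*} [MeasurableSpace Ω] {P : Measure Ω}
  {H : Fin n → Ω → ℝ} {Y : ℕ → Ω → ℝ}

namespace IsRandomness

lemma measurable_elim (h : IsRandomness P H Y) (i : Fin n ⊕ ℕ) : Measurable (Sum.elim H Y i) := by
  cases i with
  | inl v => exact h.measurable_H v
  | inr i => exact h.measurable_Y i

lemma iIndepFun_H (h : IsRandomness P H Y) : iIndepFun H P := by
  have := iIndepFun.precomp (g := Sum.inl) Sum.inl_injective h.indep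
  exact this

lemma iIndepFun_Y (h : IsRandomness P H Y) : iIndepFun Y P := by
  have := iIndepFun.precomp (g := Sum.inr) Sum.inr_injective h.indep
  exact this

lemma measurable_Y_pi (h : IsRandomness P H Y) : Measurable fun ω i => Y i ω :=
  measurable_pi_lambda _ h.measurable_Y

lemma measurable_H_pi (h : IsRandomness P H Y) : Measurable fun ω v => H v ω :=
  measurable_pi_lambda _ h.measurable_H

lemma measurable_minValue (h : IsRandomness P H Y) (v : Fin n) :
    Measurable fun ω => minValue σ m v fun i => Y i ω :=
  (GSampling.measurable_minValue v).comp h.measurable_Y_pi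

lemma indepFun_minValue (h : IsRandomness P H Y) (v : Fin n) :
    IndepFun (fun ω => minValue σ m v fun i => Y i ω) (H v) P := by
  classical
  exact indepFun_of_disjoint h.measurable_elim h.indep
    (S := (updatesOf σ m v).map ⟨Sum.inr, Sum.inr_injective⟩) (T := {Sum.inl v})
    (φ := fun x => minValue σ m v fun i => x (Sum.inr i)) (ψ := fun x => x (Sum.inl v))
    (by simp) ((GSampling.measurable_minValue v).comp (by fun_prop)) (by fun_prop)
    (fun x y hxy => minValue_congr v fun i hi => hxy _ (Finset.mem_map_of_mem _ hi))
    (fun x y hxy => hxy _ (Finset.mem_singleton_self _))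

/-- The vector of the minima is independent of the vector of the hash values. -/
lemma indepFun_minValue_H (h : IsRandomness P H Y) :
    IndepFun (fun ω v => minValue σ m v fun i => Y i ω) (fun ω v => H v ω) P := by
  classical
  refine indepFun_of_disjoint h.measurable_elim h.indep
    (S := (Finset.range m).map ⟨Sum.inr, Sum.inr_injective⟩)
    (T := Finset.univ.map ⟨Sum.inl, Sum.inl_injective⟩)
    (φ := fun x v => minValue σ m v fun i => x (Sum.inr i)) (ψ := fun x v => x (Sum.inl v))
    ?_ (measurable_pi_lambda _ fun v => (GSampling.measurable_minValue v).comp (by fun_prop))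
    (by fun_prop) (fun x y hxy => ?_) (fun x y hxy => ?_)
  · rw [Finset.disjoint_left]
    simp
  · ext v
    exact minValue_congr v fun i hi =>
      hxy _ (Finset.mem_map_of_mem _ (Finset.mem_range.2 (mem_updatesOf.1 hi).1))
  · ext v
    exact hxy _ (Finset.mem_map_of_mem _ (Finset.mem_univ v))

variable {G : ℝ≥0 → ℝ}

lemma measurable_toReal_level (h : IsRandomness P H Y) (hG : G ∈ classG) (v : Fin n) :
    Measurable fun ω => (level G σ m (fun v => H v ω) (fun i => Y i ω) v).toReal :=
  ((measurable_levelFn hG).comp ((h.measurable_minValue v).prodMk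
    (h.measurable_H v))).ennreal_toReal

/-- The level of `v` depends only on `H v` and on the `Y i` of the updates of `v`; these sets of
variables are disjoint. -/
lemma iIndepFun_toReal_level (h : IsRandomness P H Y) (hG : G ∈ classG) :
    iIndepFun (fun v ω => (level G σ m (fun v => H v ω) (fun i => Y i ω) v).toReal) P := by
  classical
  refine iIndepFun_of_disjoint h.measurable_elim h.indep
    (S := fun v => insert (Sum.inl v) ((updatesOf σ m v).map ⟨Sum.inr, Sum.inr_injective⟩))
    (φ := fun v x => (levelFn G (minValue σ m v fun i => x (Sum.inr i)) (x (Sum.inl v))).toReal)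
    (fun u v huv => ?_) (fun v => ?_) (fun v x y hxy => ?_)
  · refine Finset.disjoint_left.2 ?_
    intro i hi hi'
    simp only [Finset.mem_insert, Finset.mem_map, Function.Embedding.coeFn_mk, mem_updatesOf]
      at hi hi'
    rcases hi with rfl | ⟨j, hj, rfl⟩ <;> rcases hi' with hi' | ⟨j', hj', e⟩
    · exact huv (Sum.inl_injective hi')
    · exact absurd e (by simp)
    · exact absurd hi' (by simp)
    · rw [Sum.inr_injective e] at hj'
      exact huv (hj.2.symm.trans hj'.2)
  · exact ((measurable_levelFn hG).comp (((GSampling.measurable_minValue v).comp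
      (by fun_prop)).prodMk (by fun_prop))).ennreal_toReal
  · have e1 : x (Sum.inl v) = y (Sum.inl v) := hxy _ (Finset.mem_insert_self _ _)
    have e2 : (minValue σ m v fun i => x (Sum.inr i)) = minValue σ m v fun i => y (Sum.inr i) :=
      minValue_congr v fun i hi =>
        hxy _ (Finset.mem_insert_of_mem (Finset.mem_map_of_mem _ hi))
    simp only [e1, e2]

variable [IsProbabilityMeasure P]

lemma ae_injective_H (h : IsRandomness P H Y) :
    ∀ᵐ ω ∂P, Function.Injective fun v => H v ω := by
  have := ae_injOn_of_iIndepFun h.measurable_H h.iIndepFun_H Finset.univ fun v _ => by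
    rw [h.law_H]
    infer_instance
  filter_upwards [this] with ω hω
  rwa [Finset.coe_univ, Set.injOn_univ] at hω

/-- The minimum of the exponential variables of `v` has rate `x v`. -/
lemma map_minValue (h : IsRandomness P H Y) (hσ : ∀ i, 0 < (σ i).2) {v : Fin n}
    (hv : v ∈ touched σ m) :
    P.map (fun ω => minValue σ m v fun i => Y i ω) = expMeasure (vec σ m v) := by
  have := Measure.isProbabilityMeasure_map (μ := P)
    (h.measurable_minValue (σ := σ) (m := m) v).aemeasurable
  refine eq_expMeasure (NNReal.coe_pos.2 (vec_pos hσ hv)) _ fun t ht => ?_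
  have hne := mem_touched.1 hv
  have e : (fun ω => minValue σ m v fun i => Y i ω) ⁻¹' Ioi t
      = ⋂ i ∈ updatesOf σ m v, Y i ⁻¹' Ioi (((σ i).2 : ℝ) * t) := by
    ext ω
    simp only [mem_preimage, mem_Ioi, mem_iInter, minValue, dif_pos hne, Finset.lt_inf'_iff]
    exact forall₂_congr fun i _ => lt_div_iff₀' (NNReal.coe_pos.2 (hσ i))
  rw [Measure.map_apply (h.measurable_minValue v) measurableSet_Ioi, e,
    h.iIndepFun_Y.measure_inter_preimage_eq_mul _ fun _ _ => measurableSet_Ioi,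
    vec_eq_sum_updatesOf, NNReal.coe_sum, Finset.sum_mul, ← Finset.sum_neg_distrib, Real.exp_sum,
    ENNReal.ofReal_prod_of_nonneg fun _ _ => (Real.exp_pos _).le]
  refine Finset.prod_congr rfl fun i _ => ?_
  rw [← Measure.map_apply (h.measurable_Y i) measurableSet_Ioi, h.law_Y,
    expMeasure_Ioi one_pos (by positivity), one_mul]

lemma map_toReal_level (h : IsRandomness P H Y) (hG : G ∈ classG) (hσ : ∀ i, 0 < (σ i).2)
    {v : Fin n} (hv : v ∈ touched σ m) (hGv : 0 < G (vec σ m v)) :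
    P.map (fun ω => (level G σ m (fun v => H v ω) (fun i => Y i ω) v).toReal)
      = expMeasure (G (vec σ m v)) :=
  map_toReal_levelFn hG (h.measurable_minValue v) (h.measurable_H v) (h.indepFun_minValue v)
    (vec_pos hσ hv) hGv (h.map_minValue hσ hv) (h.law_H v)

/-- Almost surely, the levels of all touched indices are finite, positive, and distinct. -/
lemma ae_level (h : IsRandomness P H Y) (hG : G ∈ classG) (hσ : ∀ i, 0 < (σ i).2)
    (hGv : ∀ v ∈ touched σ m, 0 < G (vec σ m v)) :
    ∀ᵐ ω ∂P, (∀ v ∈ touched σ m, level G σ m (fun v => H v ω) (fun i => Y i ω) v ≠ ⊤ ∧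
        0 < (level G σ m (fun v => H v ω) (fun i => Y i ω) v).toReal) ∧
      Set.InjOn (level G σ m (fun v => H v ω) (fun i => Y i ω)) (touched σ m) := by
  have h1 : ∀ᵐ ω ∂P, ∀ v ∈ touched σ m,
      level G σ m (fun v => H v ω) (fun i => Y i ω) v ≠ ⊤ := by
    rw [Finset.eventually_all]
    exact fun v hv => levelFn_ne_top_ae hG (h.measurable_minValue v) (h.measurable_H v)
      (h.indepFun_minValue v) (vec_pos hσ hv) (hGv v hv) (h.map_minValue hσ hv) (h.law_H v)
  have h2 : ∀ᵐ ω ∂P, ∀ v ∈ touched σ m,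
      0 < (level G σ m (fun v => H v ω) (fun i => Y i ω) v).toReal := by
    rw [Finset.eventually_all]
    intro v hv
    have hm := h.measurable_toReal_level (σ := σ) (m := m) hG v
    have := isProbabilityMeasure_expMeasure (hGv v hv)
    have h3 : ∀ᵐ x ∂(P.map fun ω => (level G σ m (fun v => H v ω) (fun i => Y i ω) v).toReal),
        x ∈ Ioi (0 : ℝ) := by
      rw [h.map_toReal_level hG hσ hv (hGv v hv)]
      refine (mem_ae_iff_prob_eq_one measurableSet_Ioi).2 ?_
      rw [expMeasure_Ioi (hGv v hv) le_rfl]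
      simp
    exact ae_of_ae_map hm.aemeasurable h3
  have h3 := ae_injOn_of_iIndepFun (h.measurable_toReal_level (σ := σ) (m := m) hG)
    (h.iIndepFun_toReal_level hG) (touched σ m) fun v hv => by
      rw [h.map_toReal_level hG hσ hv (hGv v hv), expMeasure_eq_withDensity]
      infer_instance
  filter_upwards [h1, h2, h3] with ω hω1 hω2 hω3
  exact ⟨fun v hv => ⟨hω1 v hv, hω2 v hv⟩,
    fun u hu v hv e => hω3 hu hv (congrArg ENNReal.toReal e)⟩

/-- The law of the list of the `k` indices of smallest level. -/
theorem measureReal_report (h : IsRandomness P H Y) (hG : G ∈ classG) (hσ : ∀ i, 0 < (σ i).2)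
    {k : ℕ} (hk : k ≤ (Finset.univ.filter fun v => 0 < G (vec σ m v)).card) (v : Fin k → Fin n)
    (hv : Function.Injective v) :
    P.real {ω | report (kMin k (levelPairs (touched σ m)
        (level G σ m (fun v => H v ω) (fun i => Y i ω)))) = List.ofFn v}
      = worProb G (vec σ m) v := by
  -- For `k > 0` some weight is positive, hence by `classG_pos` so is the weight of every touched
  -- index. For `k = 0` all weights may vanish, but the list is empty.
  rcases Nat.eq_zero_or_pos k with rfl | hk0
  · have : ∀ ω, report (kMin 0 (levelPairs (touched σ m)
        (level G σ m (fun v => H v ω) (fun i => Y i ω)))) = List.ofFn v := by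
      intro ω
      rw [List.ofFn_zero, ← List.length_eq_zero_iff, length_report, ← Nat.le_zero]
      exact card_kMin_le 0 _
    simp [this, worProb]
  obtain ⟨w, hw⟩ := Finset.card_pos.1 (hk0.trans_le hk)
  have hGw : 0 < G (vec σ m w) := (Finset.mem_filter.1 hw).2
  have hGv : ∀ v ∈ touched σ m, 0 < G (vec σ m v) := fun v hv => classG_pos hG hGw (vec_pos hσ hv)
  have hae := h.ae_level hG hσ hGv
  have hnd : (List.ofFn v).Nodup := List.nodup_ofFn.2 hv
  -- An index that was never updated is not reported and has weight zero, so both sides vanish.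
  by_cases hmem : ∀ u ∈ List.ofFn v, u ∈ touched σ m
  swap
  · have h0 : {ω | report (kMin k (levelPairs (touched σ m)
        (level G σ m (fun v => H v ω) (fun i => Y i ω)))) = List.ofFn v} = ∅ := by
      ext ω
      refine iff_of_false (fun hω => hmem fun u hu => ?_) (notMem_empty ω)
      rw [← show _ = List.ofFn v from hω] at hu
      exact (mem_levelPairs.1 (kMin_subset _ _ ((mem_report snd_eq_of_mem_kMin).1 hu))).1
    rw [h0, measureReal_empty]
    push Not at hmem
    obtain ⟨u, hu, hut⟩ := hmem
    obtain ⟨i, rfl⟩ := (List.mem_ofFn' _ _).1 hu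
    refine (Finset.prod_eq_zero (Finset.mem_univ i) ?_).symm
    rw [vec_eq_zero hut, classG_zero hG, zero_div]
  have hmeas := measure_listsFirst (h.measurable_toReal_level (σ := σ) (m := m) hG)
    (h.iIndepFun_toReal_level hG) (r := fun u => G (vec σ m u)) (List.ofFn v) hnd (touched σ m)
    hmem hGv (fun u hu => h.map_toReal_level hG hσ hu (hGv u hu)) 0 le_rfl
  have hcongr : P {ω | report (kMin k (levelPairs (touched σ m)
        (level G σ m (fun v => H v ω) (fun i => Y i ω)))) = List.ofFn v}
      = P {ω | (∀ u ∈ touched σ m, 0 < (level G σ m (fun v => H v ω) (fun i => Y i ω) u).toReal) ∧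
        ListsFirst (fun u => (level G σ m (fun v => H v ω) (fun i => Y i ω) u).toReal)
          (List.ofFn v) (touched σ m)} := by
    refine measure_congr ?_
    filter_upwards [hae] with ω hω
    refine propext ?_
    change report (kMin k (levelPairs (touched σ m)
        (level G σ m (fun v => H v ω) (fun i => Y i ω)))) = List.ofFn v ↔
      (∀ u ∈ touched σ m, 0 < (level G σ m (fun v => H v ω) (fun i => Y i ω) u).toReal) ∧
        ListsFirst (fun u => (level G σ m (fun v => H v ω) (fun i => Y i ω) u).toReal)
          (List.ofFn v) (touched σ m)
    rw [report_kMin_eq_iff hω.2 hnd List.length_ofFn, and_iff_right hmem,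
      and_iff_right fun u hu => (hω.1 u hu).2]
    have hlt : ∀ u ∈ touched σ m, ∀ w ∈ touched σ m,
        ((level G σ m (fun v => H v ω) (fun i => Y i ω) u).toReal
          < (level G σ m (fun v => H v ω) (fun i => Y i ω) w).toReal ↔
        level G σ m (fun v => H v ω) (fun i => Y i ω) u
          < level G σ m (fun v => H v ω) (fun i => Y i ω) w) := fun u hu w hw =>
      ENNReal.toReal_lt_toReal (hω.1 u hu).1 (hω.1 w hw).1
    refine and_congr ⟨fun hp => hp.imp_of_mem fun ha hb => (hlt _ (hmem _ ha) _ (hmem _ hb)).2,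
      fun hp => hp.imp_of_mem fun ha hb => (hlt _ (hmem _ ha) _ (hmem _ hb)).1⟩ ?_
    exact forall₂_congr fun a ha => forall₂_congr fun b hb => imp_congr_right fun _ =>
      (hlt _ (hmem _ ha) _ hb).symm
  rw [measureReal_def, hcongr, hmeas, worList_ofFn]
  have hsum : ∑ u ∈ touched σ m, G (vec σ m u) = ∑ u, G (vec σ m u) := by
    refine Finset.sum_subset (Finset.subset_univ _) fun u _ hu => ?_
    rw [vec_eq_zero hu, classG_zero hG]
  rw [hsum, mul_zero, neg_zero, Real.exp_zero, one_mul, ENNReal.toReal_ofReal, worProb]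
  refine Finset.prod_nonneg fun i _ => div_nonneg (classG_nonneg hG _) (sub_nonneg.2 ?_)
  rw [← Finset.sum_image (f := fun u => G (vec σ m u)) (g := v) fun a _ b _ e => hv e]
  exact Finset.sum_le_sum_of_subset_of_nonneg (Finset.subset_univ _)
    fun u _ _ => classG_nonneg hG _

end IsRandomness

end Randomness

/-! ### The size of the Pareto frontier -/

section FrontierSize

variable {ι : Type*}

-- Deleting `i` can only lower the number of dominators of the others. For `i` itself the condition
-- on `H` is automatic, so only its rank in `A` counts.
open Classical in
lemma frontierCard_le_of_max {k : ℕ} {A H : ι → ℝ} {s : Finset ι} {i : ι}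
    (hmax : ∀ u ∈ s, H u ≤ H i) :
    frontierCard k A H s ≤ frontierCard k A H (s.erase i)
      + if (s.filter fun u => u ≠ i ∧ A u ≤ A i).card < k then 1 else 0 := by
  have hsub : (s.filter fun v => (s.filter fun u => u ≠ v ∧ A u ≤ A v ∧ H u ≤ H v).card < k)
      ⊆ ((s.erase i).filter fun v =>
          ((s.erase i).filter fun u => u ≠ v ∧ A u ≤ A v ∧ H u ≤ H v).card < k)
        ∪ (if (s.filter fun u => u ≠ i ∧ A u ≤ A i).card < k then {i} else ∅) := by
    intro v hv
    rw [Finset.mem_filter] at hv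
    rw [Finset.mem_union]
    by_cases hvi : v = i
    · subst hvi
      have : (s.filter fun u => u ≠ v ∧ A u ≤ A v) ⊆
          (s.filter fun u => u ≠ v ∧ A u ≤ A v ∧ H u ≤ H v) := by
        intro u hu
        rw [Finset.mem_filter] at hu ⊢
        exact ⟨hu.1, hu.2.1, hu.2.2, hmax u hu.1⟩
      rw [if_pos ((Finset.card_le_card this).trans_lt hv.2)]
      exact Or.inr (Finset.mem_singleton_self v)
    · refine Or.inl (Finset.mem_filter.2 ⟨Finset.mem_erase.2 ⟨hvi, hv.1⟩,
        (Finset.card_le_card ?_).trans_lt hv.2⟩)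
      exact Finset.filter_subset_filter _ (Finset.erase_subset i s)
  refine (Finset.card_le_card hsub).trans ((Finset.card_union_le _ _).trans ?_)
  refine add_le_add le_rfl ?_
  split_ifs <;> simp

-- Among the items counted, the one with the largest `A` has all the others at or below it, hence
-- fewer than `k` of them.
open Classical in
lemma card_rank_lt_le (k : ℕ) (A : ι → ℝ) (s : Finset ι) :
    (s.filter fun i => (s.filter fun u => u ≠ i ∧ A u ≤ A i).card < k).card ≤ k := by
  set R := s.filter fun i => (s.filter fun u => u ≠ i ∧ A u ≤ A i).card < k with hR
  rcases R.eq_empty_or_nonempty with h | h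
  · simp [h]
  obtain ⟨i, hi, hmax⟩ := Finset.exists_max_image R A h
  have hi' := (Finset.mem_filter.1 hi).2
  have : R.card - 1 < k := by
    rw [← Finset.card_erase_of_mem hi]
    refine lt_of_le_of_lt (Finset.card_le_card ?_) hi'
    intro u hu
    rw [Finset.mem_erase] at hu
    exact Finset.mem_filter.2 ⟨(Finset.mem_filter.1 hu.2).1, hu.1, hmax u hu.2⟩
  omega

lemma frontierCard_congr {k : ℕ} {A H H' : ι → ℝ} {s : Finset ι} (h : ∀ u ∈ s, H u = H' u) :
    frontierCard k A H s = frontierCard k A H' s := by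
  classical
  unfold frontierCard
  congr 1
  refine Finset.filter_congr fun v hv => ?_
  have : (s.filter fun u => u ≠ v ∧ A u ≤ A v ∧ H u ≤ H v)
      = s.filter fun u => u ≠ v ∧ A u ≤ A v ∧ H' u ≤ H' v :=
    Finset.filter_congr fun u hu => by rw [h u hu, h v hv]
  rw [this]

lemma measurable_frontierCard (k : ℕ) (s : Finset ι) :
    Measurable fun p : (ι → ℝ) × (ι → ℝ) => frontierCard k p.1 p.2 s := by
  classical
  have h1 : ∀ v u : ι,
      MeasurableSet {p : (ι → ℝ) × (ι → ℝ) | u ≠ v ∧ p.1 u ≤ p.1 v ∧ p.2 u ≤ p.2 v} := by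
    intro v u
    have h1 : MeasurableSet {p : (ι → ℝ) × (ι → ℝ) | p.1 u ≤ p.1 v} :=
      measurableSet_le (by fun_prop) (by fun_prop)
    have h2 : MeasurableSet {p : (ι → ℝ) × (ι → ℝ) | p.2 u ≤ p.2 v} :=
      measurableSet_le (by fun_prop) (by fun_prop)
    exact (MeasurableSet.const (u ≠ v)).inter (h1.inter h2)
  have h2 : ∀ v : ι, Measurable fun p : (ι → ℝ) × (ι → ℝ) =>
      (s.filter fun u => u ≠ v ∧ p.1 u ≤ p.1 v ∧ p.2 u ≤ p.2 v).card := by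
    intro v
    simp only [Finset.card_filter]
    exact Finset.measurable_sum _ fun u _ =>
      Measurable.ite (h1 v u) measurable_const measurable_const
  have h3 : (fun p : (ι → ℝ) × (ι → ℝ) => frontierCard k p.1 p.2 s) = fun p => ∑ v ∈ s,
      if (s.filter fun u => u ≠ v ∧ p.1 u ≤ p.1 v ∧ p.2 u ≤ p.2 v).card < k then 1 else 0 := by
    ext p
    rw [frontierCard, Finset.card_filter]
  rw [h3]
  exact Finset.measurable_sum _ fun v _ =>
    Measurable.ite (measurableSet_lt (h2 v) measurable_const) measurable_const measurable_const

open Classical in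
/-- The exponential of the size of the frontier, on the event that all values are at most `y`. -/
def frontierExp (k : ℕ) (A : ι → ℝ) (s : Finset ι) (y : ℝ) (z : ι → ℝ) : ℝ≥0∞ :=
  if ∀ u ∈ s, z u ≤ y then ENNReal.ofReal (Real.exp (frontierCard k A z s)) else 0

lemma measurable_frontierExp (k : ℕ) (A : ι → ℝ) (s : Finset ι) :
    Measurable (Function.uncurry (frontierExp k A s)) := by
  classical
  have h1 : MeasurableSet {p : ℝ × (ι → ℝ) | ∀ u ∈ s, p.2 u ≤ p.1} := by
    have : {p : ℝ × (ι → ℝ) | ∀ u ∈ s, p.2 u ≤ p.1}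
        = ⋂ u ∈ s, {p : ℝ × (ι → ℝ) | p.2 u ≤ p.1} := by
      ext p; simp
    rw [this]
    exact Finset.measurableSet_biInter _ fun u _ =>
      measurableSet_le (by fun_prop) (by fun_prop)
  have h2 : Measurable fun p : ℝ × (ι → ℝ) => frontierCard k A p.2 s := by
    have h : Measurable fun p : ℝ × (ι → ℝ) => (A, p.2) := measurable_const.prodMk measurable_snd
    simpa only [Function.comp_def] using (measurable_frontierCard k s).comp h
  have h3 : Measurable fun j : ℕ => ENNReal.ofReal (Real.exp j) := measurable_from_top
  have h4 := (h3.comp h2).indicator h1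
  have h5 : Function.uncurry (frontierExp k A s)
      = {p : ℝ × (ι → ℝ) | ∀ u ∈ s, p.2 u ≤ p.1}.indicator
        ((fun j : ℕ => ENNReal.ofReal (Real.exp j)) ∘ fun p => frontierCard k A p.2 s) := by
    ext p
    simp only [Function.uncurry, frontierExp, indicator_apply, mem_ofPred_eq, Function.comp]
  rw [h5]
  exact h4

/-- The factor that bounds the moment generating function of the size. -/
def sizeFactor (k N : ℕ) : ℝ :=
  ∏ j ∈ Finset.range N, (1 + (Real.exp 1 - 1) * k / ((j : ℝ) + 1))

lemma sizeFactor_nonneg (k N : ℕ) : 0 ≤ sizeFactor k N := by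
  have : 0 ≤ Real.exp 1 - 1 := by linarith [Real.add_one_le_exp 1]
  exact Finset.prod_nonneg fun j _ => by positivity

open Classical in
/-- The weight of the item `i` with the largest value: `e` or `1`. -/
def topWeight (k : ℕ) (A : ι → ℝ) (s : Finset ι) (i : ι) : ℝ :=
  Real.exp (if (s.filter fun u => u ≠ i ∧ A u ≤ A i).card < k then 1 else 0)

lemma topWeight_nonneg (k : ℕ) (A : ι → ℝ) (s : Finset ι) (i : ι) : 0 ≤ topWeight k A s i :=
  (Real.exp_pos _).le

/-- At most `k` items have weight `e`, and all others have weight `1`. -/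
lemma sum_topWeight_le (k : ℕ) (A : ι → ℝ) (s : Finset ι) :
    ∑ i ∈ s, topWeight k A s i ≤ s.card + (Real.exp 1 - 1) * k := by
  classical
  have he : 0 ≤ Real.exp 1 - 1 := by linarith [Real.add_one_le_exp 1]
  have h1 : ∀ i, topWeight k A s i
      = 1 + (Real.exp 1 - 1) *
        (if (s.filter fun u => u ≠ i ∧ A u ≤ A i).card < k then 1 else 0) := by
    intro i
    rw [topWeight]
    split_ifs <;> simp
  simp only [h1]
  rw [Finset.sum_add_distrib, ← Finset.mul_sum, Finset.sum_const, nsmul_eq_mul, mul_one,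
    Finset.sum_boole]
  have := card_rank_lt_le k A s
  gcongr

-- The term of the item with the largest value already bounds the left side. Summing over all `i`
-- removes the dependence on which item that is, and ties only add to the sum.
open Classical in
lemma frontierExp_le_sum (k : ℕ) (A : ι → ℝ) {s : Finset ι} (hs : s.Nonempty)
    (y : ℝ) (z : ι → ℝ) :
    frontierExp k A s y z ≤ ∑ i ∈ s, ENNReal.ofReal (topWeight k A s i) *
      (Iic y).indicator (fun x => frontierExp k A (s.erase i) x z) (z i) := by
  by_cases h : ∀ u ∈ s, z u ≤ y
  swap
  · rw [frontierExp, if_neg h]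
    exact zero_le
  obtain ⟨i, hi, hmax⟩ := Finset.exists_max_image s z hs
  refine le_trans ?_ (Finset.single_le_sum (f := fun i => ENNReal.ofReal (topWeight k A s i) *
      (Iic y).indicator (fun x => frontierExp k A (s.erase i) x z) (z i))
    (fun _ _ => zero_le) hi)
  rw [indicator_of_mem (mem_Iic.2 (h i hi)), frontierExp, if_pos h, frontierExp,
    if_pos fun u hu => hmax u (Finset.mem_of_mem_erase hu),
    ← ENNReal.ofReal_mul (topWeight_nonneg k A s i), topWeight, ← Real.exp_add]
  refine ENNReal.ofReal_le_ofReal (Real.exp_le_exp.2 ?_)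
  have := frontierCard_le_of_max (k := k) (A := A) hmax
  rw [add_comm]
  convert! (Nat.cast_le (α := ℝ)).2 this
  push_cast
  rfl

lemma lintegral_pow_restrict {h : ℝ} (h0 : 0 ≤ h) (h1 : h ≤ 1) (N : ℕ) {c : ℝ} (hc : 0 ≤ c)
    {g : ℝ → ℝ≥0∞} (hg : ∀ x, 0 ≤ x → x ≤ 1 → g x ≤ ENNReal.ofReal (x ^ N * c)) :
    ∫⁻ x, (Iic h).indicator g x ∂(volume.restrict (Icc (0 : ℝ) 1))
      ≤ ENNReal.ofReal (h ^ (N + 1) / (N + 1) * c) := by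
  rw [lintegral_indicator measurableSet_Iic, Measure.restrict_restrict measurableSet_Iic]
  have hI : Iic h ∩ Icc 0 1 = Icc 0 h := by
    ext x
    simp only [mem_inter_iff, mem_Iic, mem_Icc]
    exact ⟨fun hx => ⟨hx.2.1, hx.1⟩, fun hx => ⟨hx.2, hx.1, hx.2.trans h1⟩⟩
  rw [hI]
  calc ∫⁻ x in Icc 0 h, g x ≤ ∫⁻ x in Icc 0 h, ENNReal.ofReal (x ^ N * c) :=
        setLIntegral_mono' measurableSet_Icc fun x hx => hg x hx.1 (hx.2.trans h1)
    _ = ENNReal.ofReal (∫ x in Icc 0 h, x ^ N * c) := by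
        rw [ofReal_integral_eq_lintegral_ofReal]
        · exact (Continuous.continuousOn (by fun_prop)).integrableOn_compact isCompact_Icc
        · filter_upwards [ae_restrict_mem measurableSet_Icc] with x hx
          exact mul_nonneg (pow_nonneg hx.1 N) hc
    _ = ENNReal.ofReal (h ^ (N + 1) / (N + 1) * c) := by
        rw [integral_Icc_eq_integral_Ioc, ← intervalIntegral.integral_of_le h0,
          intervalIntegral.integral_mul_const, integral_pow]
        simp

variable {Ω : Type*} [MeasurableSpace Ω] {P : Measure Ω} [IsProbabilityMeasure P]

/-- The moment generating function of the size of the frontier, for fixed first coordinates and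
independent uniform second coordinates. -/
theorem lintegral_frontierExp_le {H : ι → Ω → ℝ} (hH : ∀ v, Measurable (H v))
    (hind : iIndepFun H P) (hlaw : ∀ v, P.map (H v) = volume.restrict (Icc (0 : ℝ) 1))
    (k : ℕ) (A : ι → ℝ) (N : ℕ) (s : Finset ι) (hs : s.card = N) {h : ℝ} (h0 : 0 ≤ h)
    (h1 : h ≤ 1) :
    ∫⁻ ω, frontierExp k A s h (fun v => H v ω) ∂P ≤ ENNReal.ofReal (h ^ N * sizeFactor k N) := by
  classical
  -- The bound `h` on all values must vary: given that the largest value is `x`, the other `N`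
  -- values are at most `x`, which produces the factor `x ^ N`.
  induction N generalizing s h with
  | zero =>
    rw [Finset.card_eq_zero] at hs
    subst hs
    simp [frontierExp, frontierCard, sizeFactor]
  | succ N ih =>
    have hne : s.Nonempty := Finset.card_pos.1 (by omega)
    have hpi : Measurable fun ω v => H v ω := measurable_pi_lambda _ hH
    have hterm : ∀ i ∈ s, ∫⁻ ω, (Iic h).indicator
        (fun x => frontierExp k A (s.erase i) x fun v => H v ω) (H i ω) ∂P
        ≤ ENNReal.ofReal (h ^ (N + 1) / (N + 1) * sizeFactor k N) := by
      intro i hi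
      have hcard : (s.erase i).card = N := by
        rw [Finset.card_erase_of_mem hi, hs, Nat.add_sub_cancel]
      set Z : Ω → ι → ℝ := fun ω u => if u ∈ s.erase i then H u ω else 0 with hZ
      have hF : ∀ x ω, frontierExp k A (s.erase i) x (Z ω)
          = frontierExp k A (s.erase i) x fun v => H v ω := by
        intro x ω
        have hZH : ∀ u ∈ s.erase i, Z ω u = H u ω := fun u hu => if_pos hu
        rw [frontierExp, frontierExp, frontierCard_congr hZH]
        refine if_congr (forall₂_congr fun u hu => ?_) rfl rfl
        rw [hZH u hu]
      have hI := lintegral_of_indepFun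
        (F := fun x z => (Iic h).indicator (fun x => frontierExp k A (s.erase i) x z) x)
        (hH i) (measurable_restrict hH (s.erase i))
        (indepFun_restrict hH hind (Finset.notMem_erase i s)) (by
          have : (Function.uncurry fun (x : ℝ) (z : ι → ℝ) =>
              (Iic h).indicator (fun x => frontierExp k A (s.erase i) x z) x)
              = (Prod.fst ⁻¹' Iic h).indicator
                (Function.uncurry (frontierExp k A (s.erase i))) := by
            ext p
            by_cases hp : p.1 ≤ h
            · rw [indicator_of_mem (by exact hp), Function.uncurry, indicator_of_mem (by exact hp)]
              rfl
            · rw [indicator_of_notMem (by exact hp), Function.uncurry,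
                indicator_of_notMem (by exact hp)]
          rw [this]
          exact (measurable_frontierExp k A _).indicator (measurable_fst measurableSet_Iic))
      rw [hlaw i] at hI
      have e1 : ∀ x ω, (Iic h).indicator (fun x => frontierExp k A (s.erase i) x (Z ω)) x
          = (Iic h).indicator (fun x => frontierExp k A (s.erase i) x fun v => H v ω) x := by
        intro x ω
        simp only [hF]
      have e2 : ∀ x, ∫⁻ ω, (Iic h).indicator
          (fun x => frontierExp k A (s.erase i) x fun v => H v ω) x ∂P
          = (Iic h).indicator
            (fun x => ∫⁻ ω, frontierExp k A (s.erase i) x (fun v => H v ω) ∂P) x := by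
        intro x
        by_cases hx : x ∈ Iic h
        · simp only [indicator_of_mem hx]
        · simp only [indicator_of_notMem hx, lintegral_zero]
      change ∫⁻ ω, (Iic h).indicator (fun x => frontierExp k A (s.erase i) x (Z ω)) (H i ω) ∂P
        = ∫⁻ x, ∫⁻ ω, (Iic h).indicator (fun x => frontierExp k A (s.erase i) x (Z ω)) x ∂P
          ∂(volume.restrict (Icc (0 : ℝ) 1)) at hI
      simp only [e1, e2] at hI
      rw [hI]
      exact lintegral_pow_restrict h0 h1 N (sizeFactor_nonneg k N)
        fun x hx0 hx1 => ih (s.erase i) hcard hx0 hx1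
    have hmeas : ∀ i, Measurable fun ω => (Iic h).indicator
        (fun x => frontierExp k A (s.erase i) x fun v => H v ω) (H i ω) := by
      intro i
      have : (fun ω => (Iic h).indicator
          (fun x => frontierExp k A (s.erase i) x fun v => H v ω) (H i ω))
          = (H i ⁻¹' Iic h).indicator
            fun ω => Function.uncurry (frontierExp k A (s.erase i)) (H i ω, fun v => H v ω) := by
        ext ω
        rfl
      rw [this]
      exact ((measurable_frontierExp k A _).comp ((hH i).prodMk hpi)).indicator
        (hH i measurableSet_Iic)
    calc ∫⁻ ω, frontierExp k A s h (fun v => H v ω) ∂P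
        ≤ ∫⁻ ω, ∑ i ∈ s, ENNReal.ofReal (topWeight k A s i) * (Iic h).indicator
          (fun x => frontierExp k A (s.erase i) x fun v => H v ω) (H i ω) ∂P :=
          lintegral_mono fun ω => frontierExp_le_sum k A hne h _
      _ = ∑ i ∈ s, ENNReal.ofReal (topWeight k A s i) * ∫⁻ ω, (Iic h).indicator
          (fun x => frontierExp k A (s.erase i) x fun v => H v ω) (H i ω) ∂P := by
          rw [lintegral_finsetSum _ fun i _ => (hmeas i).const_mul _]
          exact Finset.sum_congr rfl fun i _ => lintegral_const_mul _ (hmeas i)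
      _ ≤ ∑ i ∈ s, ENNReal.ofReal (topWeight k A s i) *
          ENNReal.ofReal (h ^ (N + 1) / (N + 1) * sizeFactor k N) :=
          Finset.sum_le_sum fun i hi => mul_le_mul_right (hterm i hi) _
      _ = ENNReal.ofReal ((∑ i ∈ s, topWeight k A s i) *
          (h ^ (N + 1) / (N + 1) * sizeFactor k N)) := by
          rw [← Finset.sum_mul, ENNReal.ofReal_mul
            (Finset.sum_nonneg fun i _ => topWeight_nonneg k A s i),
            ENNReal.ofReal_sum_of_nonneg fun i _ => topWeight_nonneg k A s i]
      _ ≤ ENNReal.ofReal (h ^ (N + 1) * sizeFactor k (N + 1)) := by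
          refine ENNReal.ofReal_le_ofReal ?_
          -- Dividing the total weight by `N + 1`, which comes from integrating `x ^ N`, gives
          -- exactly the new factor of `sizeFactor`.
          have h2 := sum_topWeight_le k A s
          have h3 : 0 ≤ h ^ (N + 1) / (N + 1) * sizeFactor k N :=
            mul_nonneg (by positivity) (sizeFactor_nonneg k N)
          refine (mul_le_mul_of_nonneg_right h2 h3).trans (le_of_eq ?_)
          rw [hs, sizeFactor, sizeFactor, Finset.prod_range_succ]
          push_cast
          field_simp

/-- Uses `1 + x ≤ exp x` and the bound `1 + log n` for the harmonic sum. -/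
lemma sizeFactor_le {k N n : ℕ} (hN : N ≤ n) :
    sizeFactor k N ≤ Real.exp ((Real.exp 1 - 1) * k * (1 + Real.log n)) := by
  have he : 0 ≤ Real.exp 1 - 1 := by linarith [Real.add_one_le_exp 1]
  have h1 : sizeFactor k N ≤ ∏ j ∈ Finset.range n,
      Real.exp ((Real.exp 1 - 1) * k / ((j : ℝ) + 1)) := by
    have h2 : sizeFactor k N ≤ sizeFactor k n := by
      refine monotone_nat_of_le_succ (fun j => ?_) hN
      have h3 : 0 ≤ (Real.exp 1 - 1) * k / ((j : ℝ) + 1) := by positivity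
      have h4 : sizeFactor k (j + 1)
          = sizeFactor k j * (1 + (Real.exp 1 - 1) * k / ((j : ℝ) + 1)) :=
        Finset.prod_range_succ _ _
      rw [h4]
      exact le_mul_of_one_le_right (sizeFactor_nonneg k j) (by linarith)
    refine h2.trans (Finset.prod_le_prod (fun j _ => by positivity) fun j _ => ?_)
    rw [add_comm]
    exact Real.add_one_le_exp _
  refine h1.trans ?_
  rw [← Real.exp_sum, Real.exp_le_exp]
  have h3 : ∑ j ∈ Finset.range n, (Real.exp 1 - 1) * k / ((j : ℝ) + 1)
      = (Real.exp 1 - 1) * k * (harmonic n : ℝ) := by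
    rw [harmonic, Rat.cast_sum, Finset.mul_sum]
    refine Finset.sum_congr rfl fun j _ => ?_
    push_cast
    rw [div_eq_mul_inv]
  rw [h3]
  exact mul_le_mul_of_nonneg_left (harmonic_le_one_add_log n) (by positivity)

/-- The size of the frontier exceeds `τ` with exponentially small probability. -/
theorem measure_lt_frontierCard_le {H : ι → Ω → ℝ} (hH : ∀ v, Measurable (H v))
    (hind : iIndepFun H P) (hlaw : ∀ v, P.map (H v) = volume.restrict (Icc (0 : ℝ) 1))
    (k : ℕ) (A : ι → ℝ) {s : Finset ι} {n : ℕ} (hs : s.card ≤ n) (τ : ℝ) :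
    P {ω | τ < frontierCard k A (fun v => H v ω) s}
      ≤ ENNReal.ofReal (Real.exp ((Real.exp 1 - 1) * k * (1 + Real.log n) - τ)) := by
  have h1 := lintegral_frontierExp_le hH hind hlaw k A _ s rfl zero_le_one le_rfl
  rw [one_pow, one_mul] at h1
  have hm : Measurable fun ω => frontierExp k A s 1 fun v => H v ω :=
    (measurable_frontierExp k A s).comp (measurable_const.prodMk (measurable_pi_lambda _ hH))
  have hle : ∀ᵐ ω ∂P, ∀ u ∈ s, H u ω ≤ 1 := by
    rw [Finset.eventually_all]
    intro u hu
    have : ∀ᵐ x ∂(P.map (H u)), x ≤ 1 := by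
      rw [hlaw u]
      filter_upwards [ae_restrict_mem measurableSet_Icc] with x hx using hx.2
    exact ae_of_ae_map (hH u).aemeasurable this
  -- The hash values are almost surely at most `1`, so the restriction in `frontierExp` is void and
  -- Markov's inequality applies to the exponential of the size.
  have h2 : P {ω | τ < frontierCard k A (fun v => H v ω) s}
      ≤ P {ω | ENNReal.ofReal (Real.exp τ) ≤ frontierExp k A s 1 fun v => H v ω} := by
    refine measure_mono_ae ?_
    filter_upwards [hle] with ω hω hτ
    change ENNReal.ofReal (Real.exp τ) ≤ frontierExp k A s 1 fun v => H v ω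
    rw [frontierExp, if_pos hω]
    exact ENNReal.ofReal_le_ofReal (Real.exp_le_exp.2 (le_of_lt hτ))
  refine h2.trans ((meas_ge_le_lintegral_div hm.aemeasurable
    (by simpa using Real.exp_pos τ) ENNReal.ofReal_ne_top).trans ?_)
  rw [Real.exp_sub, ENNReal.ofReal_div_of_pos (Real.exp_pos τ)]
  exact ENNReal.div_le_div_right (h1.trans (ENNReal.ofReal_le_ofReal (sizeFactor_le hs))) _

end FrontierSize

/-! ### Memory of the Pareto sampler along the stream -/

section ParetoSize

variable {n : ℕ} {σ : ℕ → Fin n × ℝ≥0} {Ω : Type*} [MeasurableSpace Ω] {P : Measure Ω}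
  [IsProbabilityMeasure P] {H : Fin n → Ω → ℝ} {Y : ℕ → Ω → ℝ}

/-- The state of the Pareto sampler at a fixed time is small with high probability. -/
theorem IsRandomness.measure_lt_card_paretoState_le (h : IsRandomness P H Y) (k m : ℕ) (τ : ℝ) :
    P {ω | τ < (paretoState k σ (fun v => H v ω) (fun i => Y i ω) m).card}
      ≤ ENNReal.ofReal (Real.exp ((Real.exp 1 - 1) * k * (1 + Real.log n) - τ)) := by
  have h1 : P {ω | τ < (paretoState k σ (fun v => H v ω) (fun i => Y i ω) m).card}
      ≤ P {ω | τ < frontierCard k (fun v => minValue σ m v fun i => Y i ω) (fun v => H v ω)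
        (touched σ m)} := by
    refine measure_mono_ae ?_
    filter_upwards [h.ae_injective_H] with ω hω hτ
    have h2 := card_kPareto_paretoTuples_le k (touched σ m)
      (fun v => minValue σ m v fun i => Y i ω) (fun v => H v ω)
    rw [← paretoState_eq_kPareto_paretoTuples k hω] at h2
    exact lt_of_lt_of_le hτ (Nat.cast_le.2 h2)
  refine h1.trans ?_
  have hA : Measurable fun ω v => minValue σ m v fun i => Y i ω :=
    measurable_pi_lambda _ fun v => h.measurable_minValue v
  -- The minima are independent of the hash values and can be frozen; the bound for fixed first
  -- coordinates is uniform in them.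
  have h2 := measure_of_indepFun hA h.measurable_H_pi h.indepFun_minValue_H
    (S := fun a => {z | τ < frontierCard k a z (touched σ m)})
    (measurableSet_lt measurable_const ((measurable_from_top (f := fun j : ℕ => (j : ℝ))).comp
      (measurable_frontierCard k (touched σ m))))
  refine h2.trans_le ?_
  have := Measure.isProbabilityMeasure_map (μ := P) hA.aemeasurable
  refine (lintegral_mono fun a => measure_lt_frontierCard_le h.measurable_H h.iIndepFun_H h.law_H
    k a (s := touched σ m) (n := n) ?_ τ).trans ?_
  · simpa using Finset.card_le_univ (touched σ m)
  · simp

/-- The state of the Pareto sampler is small at all times with high probability. -/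
theorem IsRandomness.measureReal_paretoWords_le (h : IsRandomness P H Y) (hn : 2 ≤ n)
    (C D k m : ℕ) (hm : m ≤ n ^ C) :
    P.real {ω | ∃ t ≤ m, 3 * (6 + (C : ℝ) + D) * (k * Real.log n) < (paretoWords
        (paretoState k σ (fun v => H v ω) (fun i => Y i ω) t) : ℝ)} ≤ 1 / (n : ℝ) ^ D := by
  have hn0 : (0 : ℝ) < n := by positivity
  have hlog : 1 / 2 ≤ Real.log n := by
    have h1 : Real.log 2 ≤ Real.log n := Real.log_le_log two_pos (by exact_mod_cast hn)
    linarith [Real.log_two_gt_d9]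
  -- Since `e - 1 ≤ 2` and `1 + log n ≤ 3 log n` for `log n ≥ 1/2`, the `6` absorbs the moment
  -- bound; `C` pays for the union bound and `D` for the error probability. The remaining `3` counts
  -- words per tuple.
  set τ : ℝ := (6 + (C : ℝ) + D) * (k * Real.log n) with hτ
  have hτ0 : 0 ≤ τ := by positivity
  have hsub : {ω | ∃ t ≤ m, 3 * (6 + (C : ℝ) + D) * (k * Real.log n) < (paretoWords
      (paretoState k σ (fun v => H v ω) (fun i => Y i ω) t) : ℝ)}
      ⊆ ⋃ t ∈ Finset.Icc 1 m,
        {ω | τ < (paretoState k σ (fun v => H v ω) (fun i => Y i ω) t).card} := by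
    rintro ω ⟨t, htm, ht⟩
    have ht' : τ < (paretoState k σ (fun v => H v ω) (fun i => Y i ω) t).card := by
      rw [paretoWords] at ht
      push_cast at ht
      linarith
    simp only [mem_iUnion, Finset.mem_Icc]
    -- The state at time `0` is empty, so only `m ≤ n ^ C` times enter the union bound.
    refine ⟨t, ⟨Nat.one_le_iff_ne_zero.2 ?_, htm⟩, ht'⟩
    rintro rfl
    simp only [paretoState, Finset.card_empty, Nat.cast_zero] at ht'
    linarith
  -- For `k = 0` the bound is zero but the state is always empty. Otherwise `k ≥ 1` lets `k log n`
  -- absorb `log n`.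
  rcases Nat.eq_zero_or_pos k with rfl | hk
  · have h0 : {ω | ∃ t ≤ m, 3 * (6 + (C : ℝ) + D) * (((0 : ℕ) : ℝ) * Real.log n) < (paretoWords
        (paretoState 0 σ (fun v => H v ω) (fun i => Y i ω) t) : ℝ)} = ∅ := by
      ext ω
      refine iff_of_false ?_ (notMem_empty ω)
      rintro ⟨t, -, ht⟩
      have : paretoState 0 σ (fun v => H v ω) (fun i => Y i ω) t = ∅ := by
        cases t with
        | zero => rfl
        | succ t => simp [paretoState, kPareto]
      simp [this, paretoWords] at ht
    rw [h0, measureReal_empty]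
    positivity
  have hexp : Real.exp ((Real.exp 1 - 1) * k * (1 + Real.log n) - τ) ≤ 1 / (n : ℝ) ^ (C + D) := by
    have h1 : 1 / (n : ℝ) ^ (C + D) = Real.exp (-((C + D : ℕ) * Real.log n)) := by
      rw [Real.exp_neg, Real.exp_nat_mul, Real.exp_log hn0, one_div]
    rw [h1, Real.exp_le_exp, hτ]
    have hk1 : (1 : ℝ) ≤ k := by exact_mod_cast hk
    have h2 : Real.exp 1 - 1 ≤ 2 := by linarith [Real.exp_one_lt_d9]
    have h3 : (Real.exp 1 - 1) * k * (1 + Real.log n) ≤ 6 * (k * Real.log n) := by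
      calc (Real.exp 1 - 1) * k * (1 + Real.log n)
          ≤ 2 * k * (3 * Real.log n) := by
            gcongr
            linarith
        _ = 6 * (k * Real.log n) := by ring
    have h4 : ((C : ℝ) + D) * Real.log n ≤ ((C : ℝ) + D) * (k * Real.log n) :=
      mul_le_mul_of_nonneg_left (le_mul_of_one_le_left (by linarith) hk1) (by positivity)
    push_cast
    nlinarith
  refine ENNReal.toReal_le_of_le_ofReal (by positivity) ?_
  calc P _ ≤ P (⋃ t ∈ Finset.Icc 1 m,
        {ω | τ < (paretoState k σ (fun v => H v ω) (fun i => Y i ω) t).card}) := measure_mono hsub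
    _ ≤ ∑ t ∈ Finset.Icc 1 m,
        P {ω | τ < (paretoState k σ (fun v => H v ω) (fun i => Y i ω) t).card} :=
        measure_biUnion_finset_le _ _
    _ ≤ ∑ t ∈ Finset.Icc 1 m, ENNReal.ofReal (1 / (n : ℝ) ^ (C + D)) :=
        Finset.sum_le_sum fun t _ => (h.measure_lt_card_paretoState_le k t τ).trans
          (ENNReal.ofReal_le_ofReal hexp)
    _ = ENNReal.ofReal (m * (1 / (n : ℝ) ^ (C + D))) := by
        rw [Finset.sum_const, Nat.card_Icc, Nat.add_sub_cancel, nsmul_eq_mul,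
          ENNReal.ofReal_mul (Nat.cast_nonneg m), ENNReal.ofReal_natCast]
    _ ≤ ENNReal.ofReal (1 / (n : ℝ) ^ D) := by
        refine ENNReal.ofReal_le_ofReal ?_
        have h1 : (m : ℝ) ≤ (n : ℝ) ^ C := by exact_mod_cast hm
        calc (m : ℝ) * (1 / (n : ℝ) ^ (C + D)) ≤ (n : ℝ) ^ C * (1 / (n : ℝ) ^ (C + D)) := by gcongr
          _ = 1 / (n : ℝ) ^ D := by
            rw [pow_add]
            field_simp

end ParetoSize

/-! ### The guarantees of the two samplers -/

section Samplers

variable {n : ℕ} {σ : ℕ → Fin n × ℝ≥0} {m : ℕ}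

lemma report_kMin_zero (L : Finset (Fin n × ℝ≥0∞)) : report (kMin 0 L) = [] := by
  rw [← List.length_eq_zero_iff, length_report, ← Nat.le_zero]
  exact card_kMin_le 0 L

lemma length_nodup_report_kMin_levelPairs {V : Finset (Fin n)} {k : ℕ} (hk : k ≤ V.card)
    (ℓ : Fin n → ℝ≥0∞) :
    (report (kMin k (levelPairs V ℓ))).length = k ∧ (report (kMin k (levelPairs V ℓ))).Nodup :=
  ⟨by rw [length_report, card_kMin_levelPairs hk], nodup_report snd_eq_of_mem_kMin⟩

lemma samplerWords_samplerState_le (G : ℝ≥0 → ℝ) (k : ℕ) (H : Fin n → ℝ) (Y : ℕ → ℝ) :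
    samplerWords (samplerState G k σ H Y m) ≤ 2 * k := by
  rw [samplerState_eq]
  exact Nat.mul_le_mul_left 2 (card_kMin_le k _)

/-- The query to the Pareto sampler almost surely returns what the sampler for `G` reports. -/
lemma IsRandomness.ae_paretoQuery_eq {Ω : Type*} [MeasurableSpace Ω] {P : Measure Ω}
    [IsProbabilityMeasure P] {H : Fin n → Ω → ℝ} {Y : ℕ → Ω → ℝ} (h : IsRandomness P H Y)
    {G : ℝ≥0 → ℝ} (hG : G ∈ classG) (hσ : ∀ i, 0 < (σ i).2) {k : ℕ}
    (hk : k ≤ (Finset.univ.filter fun v => 0 < G (vec σ m v)).card) :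
    ∀ᵐ ω ∂P, paretoQuery k (paretoState k σ (fun v => H v ω) (fun i => Y i ω) m) G
      = report (kMin k (levelPairs (touched σ m)
        (level G σ m (fun v => H v ω) (fun i => Y i ω)))) := by
  rcases Nat.eq_zero_or_pos k with rfl | hk0
  · exact ae_of_all _ fun ω => by rw [paretoQuery, report_kMin_zero, report_kMin_zero]
  obtain ⟨w, hw⟩ := Finset.card_pos.1 (hk0.trans_le hk)
  have hGv : ∀ v ∈ touched σ m, 0 < G (vec σ m v) := fun v hv =>
    classG_pos hG (Finset.mem_filter.1 hw).2 (vec_pos hσ hv)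
  filter_upwards [h.ae_injective_H, h.ae_level hG hσ hGv] with ω hω1 hω2
  rw [paretoQuery, paretoState_eq_kPareto_paretoTuples k hω1]
  congr 1
  exact kMin_image_kPareto levelFn_mono hω2.2

end Samplers

end GSampling

end

theorem mainTheorem4 :
    -- the `(G, k)`-Sampler-WOR: memory and output distribution
    (∀ (n k : ℕ) (G : ℝ≥0 → ℝ), G ∈ GSampling.classG →
      ∀ (σ : ℕ → Fin n × ℝ≥0), (∀ i, 0 < (σ i).2) →
      ∀ (Ω : Type*) [MeasurableSpace Ω] (P : Measure Ω) [IsProbabilityMeasure P]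
        (H : Fin n → Ω → ℝ) (Y : ℕ → Ω → ℝ), GSampling.IsRandomness P H Y →
      ∀ m : ℕ,
        (∀ ω, GSampling.samplerWords
          (GSampling.samplerState G k σ (fun v => H v ω) (fun i => Y i ω) m) ≤ 2 * k) ∧
        (k ≤ (Finset.univ.filter fun v => 0 < G (GSampling.vec σ m v)).card →
          (∀ ω,
            (GSampling.report (GSampling.samplerState G k σ
              (fun v => H v ω) (fun i => Y i ω) m)).length = k ∧
            (GSampling.report (GSampling.samplerState G k σ
              (fun v => H v ω) (fun i => Y i ω) m)).Nodup) ∧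
          ∀ v : Fin k → Fin n, Function.Injective v →
            P.real {ω | GSampling.report (GSampling.samplerState G k σ
                (fun v => H v ω) (fun i => Y i ω) m) = List.ofFn v}
              = GSampling.worProb G (GSampling.vec σ m) v)) ∧
    -- the `k`-ParetoSampler-WOR: memory, with high probability, throughout the stream
    (∀ C D : ℕ, ∃ K : ℝ, 0 < K ∧ ∀ (n k : ℕ), 2 ≤ n →
      ∀ (σ : ℕ → Fin n × ℝ≥0), (∀ i, 0 < (σ i).2) →
      ∀ (Ω : Type*) [MeasurableSpace Ω] (P : Measure Ω) [IsProbabilityMeasure P]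
        (H : Fin n → Ω → ℝ) (Y : ℕ → Ω → ℝ), GSampling.IsRandomness P H Y →
      ∀ m : ℕ, m ≤ n ^ C →
        P.real {ω | ∃ t ≤ m, K * (k * Real.log n) < (GSampling.paretoWords
          (GSampling.paretoState k σ (fun v => H v ω) (fun i => Y i ω) t) : ℝ)}
          ≤ 1 / (n : ℝ) ^ D) ∧
    -- the `k`-ParetoSampler-WOR: output distribution for every `G` given at query time
    (∀ (n k : ℕ) (σ : ℕ → Fin n × ℝ≥0), (∀ i, 0 < (σ i).2) →
      ∀ (Ω : Type*) [MeasurableSpace Ω] (P : Measure Ω) [IsProbabilityMeasure P]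
        (H : Fin n → Ω → ℝ) (Y : ℕ → Ω → ℝ), GSampling.IsRandomness P H Y →
      ∀ (m : ℕ) (G : ℝ≥0 → ℝ), G ∈ GSampling.classG →
        k ≤ (Finset.univ.filter fun v => 0 < G (GSampling.vec σ m v)).card →
          (∀ᵐ ω ∂P,
            (GSampling.paretoQuery k (GSampling.paretoState k σ
              (fun v => H v ω) (fun i => Y i ω) m) G).length = k ∧
            (GSampling.paretoQuery k (GSampling.paretoState k σ
              (fun v => H v ω) (fun i => Y i ω) m) G).Nodup) ∧
          ∀ v : Fin k → Fin n, Function.Injective v →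
            P.real {ω | GSampling.paretoQuery k (GSampling.paretoState k σ
                (fun v => H v ω) (fun i => Y i ω) m) G = List.ofFn v}
              = GSampling.worProb G (GSampling.vec σ m) v) := by
  refine ⟨fun n k G hG σ hσ Ω _ P _ H Y h m => ⟨fun ω =>
    GSampling.samplerWords_samplerState_le G k _ _, fun hk => ⟨fun ω => ?_, fun v hv => ?_⟩⟩,
    fun C D => ⟨3 * (6 + (C : ℝ) + D), by positivity,
      fun n k hn σ _ Ω _ P _ H Y h m hm => h.measureReal_paretoWords_le hn C D k m hm⟩,
    fun n k σ hσ Ω _ P _ H Y h m G hG hk => ⟨?_, fun v hv => ?_⟩⟩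
  · rw [GSampling.samplerState_eq_kMin_levelPairs]
    exact GSampling.length_nodup_report_kMin_levelPairs
      (hk.trans (Finset.card_le_card (GSampling.filter_pos_subset_touched hG))) _
  · simp only [GSampling.samplerState_eq_kMin_levelPairs]
    exact h.measureReal_report hG hσ hk v hv
  · filter_upwards [h.ae_paretoQuery_eq hG hσ hk] with ω hω
    rw [hω]
    exact GSampling.length_nodup_report_kMin_levelPairs
      (hk.trans (Finset.card_le_card (GSampling.filter_pos_subset_touched hG))) _
  -- The query almost surely returns the list of the `k` smallest levels, so its law carries over.
  · rw [← h.measureReal_report hG hσ hk v hv]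
    refine measureReal_congr ?_
    filter_upwards [h.ae_paretoQuery_eq hG hσ hk] with ω hω
    refine propext ?_
    change GSampling.paretoQuery k _ G = List.ofFn v ↔ GSampling.report _ = List.ofFn v
    rw [hω]
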